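/- Let $B=\mathbb Z_{(3)}[q_2,q_4,\Delta^{-1}]$ with $\mu=16q_2^2-64q_4$ and $\Delta=q_4^2\mu$, and let $\Gamma=B[r]/(r^3+q_2r^2+q_4r)$, a Hopf algebroid over $B$ whose left unit $\eta_L$ is the inclusion, with right unit $\eta_R(q_2)=q_2+3r$, $\eta_R(q_4)=q_4+2q_2r+3r^2$ and coproduct $\psi(r)=r\otimes1+1\otimes r$. Let $\mathrm{Ext}^*$ be the cohomology of the cobar complex $$B\xrightarrow{d}\Gamma\xrightarrow{d}\Gamma\otimes_B\Gamma\to\cdots,\qquad d(b)=\eta_R(b)-b,\quad d(\gamma)=1\otimes\gamma-\psi(\gamma)+\gamma\otimes1 .$$ Let $\psi_d:B\to B$ be the ring map $q_2\mapsto-2q_2$, $q_4\mapsto q_2^2-4q_4$, and let $\psi_{[2]}$ be the ring map $q_2\mapsto4q_2$, $q_4\mapsto16q_4$, $r\mapsto4r$ on $B$ and on $\Gamma$. Put $\Phi(x)=(\psi_{[2]}(x)-x,\ \psi_d(x)-x)$ on $B$, $\Phi=\psi_{[2]}-1$ on $\Gamma$, and $\Psi(x,y)=\psi_d(y)-x+y$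 on $B\oplus B$; let $C^*$ be the complex $$\mathrm{Ext}^0\xrightarrow{\Phi}\mathrm{Ext}^0\oplus B\xrightarrow{\Psi}B\to0,$$ so that $H^2C^*=\operatorname{coker}(\Psi:\mathrm{Ext}^0\oplus B\to B)$. In the spectral sequence of the double complex whose columns are the cobar complex, the sum of the cobar complex with differential $-d$ and of $B$ in degree $0$, and $B$ in degree $0$, with horizontal maps $\Phi,\Psi$, let $$\widetilde d:\mathrm{Ext}^1\to\operatorname{coker}\Psi=H^2C^*$$ be the $E_2$-page differential; explicitly, $\widetilde d[z]=[\Psi(y)]$ for any $y=(y_1,y_2)\in B\oplus B$ with $-d(y_1)=\Phi(z)$. Let $\alpha\in\mathrm{Ext}^1$ be the class of $r$ and $\Delta^k\alpha$ that of $\Delta^kr$. Put $s=8q_4$, $t=\mu/8$ and, for integers $m$ and $v\ge0$, $$B^m_v=(s^it^j-s^jt^i)q_2,\qquad i=\lfloor\tfrac{m-1}2\rfloor-v,\quad j=\lceil\tfrac{m+1}2\rceil+v .$$ **Theorem.** The kernel of $\widetilde d$ is $\mathbb Z/3$, generated by $\alpha$. For each integer $k\neq0$ put $v(k)=\lfloor\frac{3k-1}2\rfloor-k$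 if $k>0$ and $v(k)=\lfloor\frac{3k-1}2\rfloor-2k$ if $k<0$; then $v(k)\ge 0$, and $\widetilde d(\Delta^k\alpha)$ is a unit of $\mathbb Z_{(3)}$ times the class of $B^{3k}_{v(k)}$ in $H^2C^*$, which is nonzero. For $m=3k$, $k\ne0$, this class generates a subgroup $\mathbb Z/3^{\nu_3(6m+3)}$ of $H^2C^*$; the sum of these subgroups is direct and is the image of $\widetilde d$, so that $$\operatorname{coker}\widetilde d=H^2C^*\Big/\bigoplus_{0\neq m\in3\mathbb Z}\mathbb Z/3^{\nu_3(6m+3)} .$$ -/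

import Mathlib

open scoped TensorProduct DirectSum

noncomputable section

namespace QTwo

instance primeThree : (Ideal.span {(3 : ℤ)}).IsPrime :=
  (Ideal.span_singleton_prime (by norm_num)).2 Int.prime_three

/-- The ring `ℤ_(3)` of integers localized at the prime `3`. -/
abbrev Z3 : Type := Localization.AtPrime (Ideal.span {(3 : ℤ)})

/-- The polynomial `q₄²(16q₂² - 64q₄)` in `ℤ_(3)[q₂, q₄]`. -/
def deltaPoly : MvPolynomial (Fin 2) Z3 :=
  MvPolynomial.X 1 ^ 2 * (16 * MvPolynomial.X 0 ^ 2 - 64 * MvPolynomial.X 1)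

/-- `B = ℤ_(3)[q₂, q₄, Δ⁻¹]` with `Δ = q₄²(16q₂² - 64q₄)`. -/
abbrev B : Type := Localization.Away deltaPoly

def q2 : B := algebraMap (MvPolynomial (Fin 2) Z3) B (MvPolynomial.X 0)
def q4 : B := algebraMap (MvPolynomial (Fin 2) Z3) B (MvPolynomial.X 1)

/-- `μ = 16q₂² - 64q₄`. -/
def mu : B := 16 * q2 ^ 2 - 64 * q4

/-- The discriminant `Δ = q₄²μ`. -/
def Delta : B := q4 ^ 2 * mu

theorem algebraMap_deltaPoly : algebraMap (MvPolynomial (Fin 2) Z3) B deltaPoly = Delta := by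
  simp only [deltaPoly, Delta, mu, q2, q4, map_mul, map_pow, map_sub, map_ofNat]

theorem isUnit_Delta : IsUnit Delta := by
  rw [← algebraMap_deltaPoly]
  exact IsLocalization.Away.algebraMap_isUnit _

section lift
variable {A : Type} [CommRing A] [Algebra Z3 A]

/-- The map of `ℤ_(3)`-algebras out of `B` with prescribed values `x`, `y` on `q₂`, `q₄`. -/
def liftB (x y : A) (h : IsUnit (y ^ 2 * (16 * x ^ 2 - 64 * y))) : B →ₐ[Z3] A :=
  IsLocalization.liftAlgHom (M := Submonoid.powers deltaPoly)
    (f := MvPolynomial.aeval (R := Z3) ![x, y]) (by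
      rintro ⟨_, n, rfl⟩
      have : MvPolynomial.aeval (R := Z3) ![x, y] deltaPoly = y ^ 2 * (16 * x ^ 2 - 64 * y) := by
        simp [deltaPoly]
      simpa [this] using h.pow n)

@[simp] theorem liftB_q2 (x y : A) (h) : liftB x y h q2 = x := by
  simp [liftB, q2]

@[simp] theorem liftB_q4 (x y : A) (h) : liftB x y h q4 = y := by
  simp [liftB, q4]

theorem algHom_B_ext {f g : B →ₐ[Z3] A} (h2 : f q2 = g q2) (h4 : f q4 = g q4) : f = g := by
  apply IsLocalization.algHom_ext (Submonoid.powers deltaPoly)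
  apply MvPolynomial.algHom_ext
  intro i
  fin_cases i
  · exact h2
  · exact h4
end lift

/-- The polynomial `r³ + q₂r² + q₄r` over `B`. -/
def rPoly : Polynomial B :=
  Polynomial.X ^ 3 + Polynomial.C q2 * Polynomial.X ^ 2 + Polynomial.C q4 * Polynomial.X

/-- `Γ = B[r]/(r³ + q₂r² + q₄r)`, a `B`-algebra by the left unit. -/
abbrev Gam : Type := AdjoinRoot rPoly

def r : Gam := AdjoinRoot.root rPoly

/-- The left unit `η_L : B → Γ`. -/
def etaL : B →ₐ[Z3] Gam := IsScalarTower.toAlgHom Z3 B Gam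

theorem r_rel : r ^ 3 + etaL q2 * r ^ 2 + etaL q4 * r = 0 := by
  have h : Polynomial.eval₂ (etaL : B →+* Gam) r (Polynomial.X ^ 3 +
    Polynomial.C q2 * Polynomial.X ^ 2 + Polynomial.C q4 * Polynomial.X) = 0 :=
    AdjoinRoot.eval₂_root rPoly
  simpa using h

theorem etaR_unit_eq :
    (etaL q4 + 2 * etaL q2 * r + 3 * r ^ 2) ^ 2 *
      (16 * (etaL q2 + 3 * r) ^ 2 - 64 * (etaL q4 + 2 * etaL q2 * r + 3 * r ^ 2)) =
    etaL Delta := by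
  simp only [Delta, mu, map_mul, map_pow, map_sub, map_ofNat]
  linear_combination (16 * (-27 * r ^ 3 - 27 * etaL q2 * r ^ 2 - 27 * etaL q4 * r +
    4 * etaL q2 ^ 3 - 18 * etaL q2 * etaL q4)) * r_rel

/-- The right unit `η_R : B → Γ`, `q₂ ↦ q₂ + 3r`, `q₄ ↦ q₄ + 2q₂r + 3r²`: the substitution
`x ↦ x + r` in `y² = 4x(x² + q₂x + q₄)`. -/
def etaR : B →ₐ[Z3] Gam :=
  liftB (etaL q2 + 3 * r) (etaL q4 + 2 * etaL q2 * r + 3 * r ^ 2) (by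
    rw [etaR_unit_eq]; exact isUnit_Delta.map etaL)

theorem etaR_q2 : etaR q2 = etaL q2 + 3 * r := liftB_q2 ..
theorem etaR_q4 : etaR q4 = etaL q4 + 2 * etaL q2 * r + 3 * r ^ 2 := liftB_q4 ..

theorem etaR_Delta : etaR Delta = etaL Delta := by
  rw [← etaR_unit_eq]
  simp only [Delta, mu, etaR_q2, etaR_q4, map_mul, map_pow, map_sub, map_ofNat]

/-- `Γ`, regarded as a `B`-algebra by the right unit. -/
def GamR : Type := Gam

instance : CommRing GamR := inferInstanceAs (CommRing Gam)
instance : Algebra Z3 GamR := inferInstanceAs (Algebra Z3 Gam)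
instance : Algebra B GamR := etaR.toRingHom.toAlgebra
instance : IsScalarTower Z3 B GamR := IsScalarTower.of_algebraMap_eq fun x =>
  (etaR.commutes x).symm

/-- `Γ ⊗_B Γ`, formed with the right unit on the left factor and the left unit on the right
factor. -/
abbrev GamGam : Type := GamR ⊗[B] Gam

/-- `γ ↦ γ ⊗ 1`. -/
def inclL : Gam →ₐ[Z3] GamGam :=
  (Algebra.TensorProduct.includeLeft (R := B) (S := Z3) (A := GamR) (B := Gam) :
    GamR →ₐ[Z3] GamGam)

/-- `γ ↦ 1 ⊗ γ`. -/
def inclR : Gam →ₐ[Z3] GamGam :=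
  (Algebra.TensorProduct.includeRight (R := B) (A := GamR) (B := Gam)).restrictScalars Z3

theorem incl_balanced (b : B) : inclR (etaL b) = inclL (etaR b) := by
  exact (Algebra.TensorProduct.tmul_one_eq_one_tmul (A := GamR) (B := Gam) b).symm

theorem coprod_rel : Polynomial.eval₂ (inclL.comp etaL : B →ₐ[Z3] GamGam)
    (inclL r + inclR r) rPoly = 0 := by
  have h1 := congrArg inclL r_rel
  have h2 := congrArg inclR r_rel
  simp only [map_add, map_mul, map_pow, incl_balanced, etaR_q2, etaR_q4, map_ofNat, map_zero]
    at h1 h2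
  simp [rPoly]
  linear_combination h1 + h2

/-- The coproduct `Γ → Γ ⊗_B Γ`: `b ↦ b ⊗ 1`, `r ↦ r ⊗ 1 + 1 ⊗ r`. -/
def coprod : Gam →ₐ[Z3] GamGam :=
  AdjoinRoot.liftAlgHom rPoly (inclL.comp etaL) (inclL r + inclR r) coprod_rel

theorem coprod_etaL (b : B) : coprod (etaL b) = inclL (etaL b) :=
  AdjoinRoot.lift_of coprod_rel

theorem coprod_r : coprod r = inclL r + inclR r :=
  AdjoinRoot.lift_root coprod_rel

/-- The cobar differential `B → Γ`, `b ↦ η_R(b) - η_L(b)`. -/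
def cobarZero : B →ₗ[Z3] Gam := etaR.toLinearMap - etaL.toLinearMap

/-- The cobar differential `Γ → Γ ⊗_B Γ`, `γ ↦ 1 ⊗ γ - ψ(γ) + γ ⊗ 1`. -/
def cobarOne : Gam →ₗ[Z3] GamGam := inclR.toLinearMap - coprod.toLinearMap + inclL.toLinearMap

theorem coprod_etaR (b : B) : coprod (etaR b) = inclR (etaR b) := by
  have : coprod.comp etaR = inclR.comp etaR := by
    apply algHom_B_ext
    · simp only [AlgHom.comp_apply, etaR_q2, map_add, map_mul, map_ofNat, coprod_etaL, coprod_r,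
        incl_balanced]
      ring
    · simp only [AlgHom.comp_apply, etaR_q2, etaR_q4, map_add, map_mul, map_pow, map_ofNat,
        coprod_etaL, coprod_r, incl_balanced]
      ring
  exact DFunLike.congr_fun this b

theorem cobarOne_cobarZero (b : B) : cobarOne (cobarZero b) = 0 := by
  simp [cobarOne, cobarZero, coprod_etaL, coprod_etaR, incl_balanced]

theorem isUnit_int (n : ℤ) (h : ¬ 3 ∣ n) : IsUnit (n : Z3) := by
  have := IsLocalization.map_units Z3 (M := (Ideal.span {(3 : ℤ)}).primeCompl)
    ⟨n, fun hn => h (Ideal.mem_span_singleton.1 hn)⟩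
  simpa using this

theorem isUnit_int_alg {A : Type} [CommRing A] [Algebra Z3 A] (n : ℤ) (h : ¬ 3 ∣ n) :
    IsUnit (n : A) := by
  simpa using (isUnit_int n h).map (algebraMap Z3 A)

theorem isUnit_q4 : IsUnit q4 :=
  isUnit_of_dvd_unit ⟨q4 * mu, by rw [Delta]; ring⟩ isUnit_Delta

theorem isUnit_mu : IsUnit mu :=
  isUnit_of_dvd_unit ⟨q4 ^ 2, by rw [Delta]; ring⟩ isUnit_Delta

/-- `ψ_d : B → B`, `q₂ ↦ -2q₂`, `q₄ ↦ q₂² - 4q₄`. -/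
def psiD : B →ₐ[Z3] B :=
  liftB (-2 * q2) (q2 ^ 2 - 4 * q4) (by
    have h : (q2 ^ 2 - 4 * q4) ^ 2 * (16 * (-2 * q2) ^ 2 - 64 * (q2 ^ 2 - 4 * q4)) =
        mu ^ 2 * q4 := by rw [mu]; ring
    rw [h]
    exact (isUnit_mu.pow 2).mul isUnit_q4)

/-- `φ_f` on `B`: `q₂ ↦ q₂`, `q₄ ↦ q₄`. -/
def phiF : B →ₐ[Z3] B := AlgHom.id Z3 B

/-- `φ_q = ψ_d ∘ φ_f` on `B`. -/
def phiQ : B →ₐ[Z3] B := psiD.comp phiF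

/-- `ψ_[2]` on `B`: `q₂ ↦ 4q₂`, `q₄ ↦ 16q₄`. -/
def psiTwo : B →ₐ[Z3] B :=
  liftB (4 * q2) (16 * q4) (by
    have h : (16 * q4) ^ 2 * (16 * (4 * q2) ^ 2 - 64 * (16 * q4)) =
        ((4096 : ℤ) : B) * Delta := by rw [Delta, mu]; push_cast; ring
    rw [h]
    exact (isUnit_int_alg 4096 (by norm_num)).mul isUnit_Delta)

theorem psiTwo_rel : Polynomial.eval₂ (etaL.comp psiTwo : B →ₐ[Z3] Gam) (4 * r) rPoly = 0 := by
  have h := r_rel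
  simp [rPoly, psiTwo, map_ofNat]
  linear_combination 64 * h

/-- `ψ_[2]` on `Γ`: `q₂ ↦ 4q₂`, `q₄ ↦ 16q₄`, `r ↦ 4r`. -/
def psiTwoGam : Gam →ₐ[Z3] Gam :=
  AdjoinRoot.liftAlgHom rPoly (etaL.comp psiTwo) (4 * r) psiTwo_rel

/-- `Φ` in cobar degree `0`: `x ↦ (ψ_[2](x) - x, φ_q(x) - φ_f(x))`. -/
def PhiZero : B →ₗ[Z3] B × B :=
  (psiTwo.toLinearMap - LinearMap.id).prod (phiQ.toLinearMap - phiF.toLinearMap)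

/-- `Φ` in cobar degree `1`: `ψ_[2] - 1` (the component in the summand `B`, which is concentrated
in cobar degree `0`, is zero). -/
def PhiOne : Gam →ₗ[Z3] Gam := psiTwoGam.toLinearMap - LinearMap.id

/-- `Ψ` in cobar degree `0`: `(x, y) ↦ ψ_d(y) - φ_f(x) + y`. -/
def Psi : B × B →ₗ[Z3] B :=
  psiD.toLinearMap ∘ₗ LinearMap.snd Z3 B B - phiF.toLinearMap ∘ₗ LinearMap.fst Z3 B B
    + LinearMap.snd Z3 B B

/-- The vertical differential `-d ⊕ 0 : B ⊕ B → Γ` of the middle column. -/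
def vertMid : B × B →ₗ[Z3] Gam := -(cobarZero ∘ₗ LinearMap.fst Z3 B B)

/-- `MF = Ext⁰`, the kernel of `d : B → Γ`. -/
def MF : Submodule Z3 B := LinearMap.ker cobarZero

/-- `Ext¹ = ker(Γ → Γ ⊗_B Γ) / im(B → Γ)`. -/
abbrev Ext1 : Type :=
  LinearMap.ker cobarOne ⧸ (LinearMap.range cobarZero).submoduleOf (LinearMap.ker cobarOne)

/-- The restriction `Ψ : Ext⁰ ⊕ B → B` (the last map of the complex `C^*`). -/
def PsiMF : MF × B →ₗ[Z3] B := Psi ∘ₗ MF.subtype.prodMap LinearMap.id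

/-- `coker Ψ = H²(C^*)`, for `C^* = (Ext⁰ → Ext⁰ ⊕ B → B → 0)` with maps `Φ`, `Ψ`. -/
abbrev H2C : Type := B ⧸ LinearMap.range PsiMF

theorem phiF_apply (x : B) : phiF x = x := rfl
theorem phiQ_apply (x : B) : phiQ x = psiD x := rfl

theorem psiD_psiD (x : B) : psiD (psiD x) = psiTwo x := by
  have : psiD.comp psiD = psiTwo := by
    apply algHom_B_ext
    · simp [psiD, psiTwo, map_ofNat]; ring
    · simp [psiD, psiTwo, map_ofNat]; ring
  exact DFunLike.congr_fun this x

theorem Psi_PhiZero (x : B) : Psi (PhiZero x) = 0 := by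
  simp [Psi, PhiZero, phiF_apply, phiQ_apply, psiD_psiD]

theorem psiTwoGam_etaL (b : B) : psiTwoGam (etaL b) = etaL (psiTwo b) :=
  AdjoinRoot.lift_of psiTwo_rel

theorem psiTwoGam_r : psiTwoGam r = 4 * r :=
  AdjoinRoot.lift_root psiTwo_rel

theorem psiTwoGam_etaR (b : B) : psiTwoGam (etaR b) = etaR (psiTwo b) := by
  have : psiTwoGam.comp etaR = etaR.comp psiTwo := by
    apply algHom_B_ext
    · simp only [AlgHom.comp_apply, etaR_q2, map_add, map_mul, map_ofNat, psiTwoGam_etaL,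
        psiTwoGam_r, psiTwo, liftB_q2]
      ring
    · simp only [AlgHom.comp_apply, etaR_q4, map_add, map_mul, map_pow, map_ofNat, psiTwoGam_etaL,
        psiTwoGam_r, psiTwo, liftB_q2, liftB_q4]
      ring
  exact DFunLike.congr_fun this b

/-- `Φ` anticommutes with the vertical differentials `d` and `-d ⊕ 0`. -/
theorem vertMid_PhiZero (b : B) : vertMid (PhiZero b) = -PhiOne (cobarZero b) := by
  simp [vertMid, PhiZero, PhiOne, cobarZero, psiTwoGam_etaL, psiTwoGam_etaR]
  abel

/-- The graph of the differential `d₂ : E₂^{0,1} → E₂^{2,0}` of the double complex: the class of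
a cocycle `z ∈ Γ` is related to the class of `Ψ(y)` whenever `y ∈ B ⊕ B` satisfies
`(-d ⊕ 0)(y) = Φ(z)`. -/
def zigzag : Submodule Z3 (Ext1 × H2C) where
  carrier := {p | ∃ (z : LinearMap.ker cobarOne) (y : B × B), vertMid y = PhiOne z ∧
    Submodule.Quotient.mk z = p.1 ∧ Submodule.Quotient.mk (Psi y) = p.2}
  add_mem' := by
    rintro p p' ⟨z, y, h, h1, h2⟩ ⟨z', y', h', h1', h2'⟩
    exact ⟨z + z', y + y', by simp [h, h'], by simp [← h1, ← h1'], by simp [← h2, ← h2']⟩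
  zero_mem' := ⟨0, 0, by simp, by simp, by simp⟩
  smul_mem' := by
    rintro c p ⟨z, y, h, h1, h2⟩
    exact ⟨c • z, c • y, by simp [h], by simp [← h1], by simp [← h2]⟩

theorem zigzag_functional (p : Ext1 × H2C) (hp : p ∈ zigzag) (h0 : p.1 = 0) : p.2 = 0 := by
  obtain ⟨z, y, h, h1, h2⟩ := hp
  rw [h0, Submodule.Quotient.mk_eq_zero] at h1
  obtain ⟨b, hb⟩ := h1
  change cobarZero b = z at hb
  rw [← h2, Submodule.Quotient.mk_eq_zero]
  have hm : y.1 + (psiTwo b - b) ∈ MF := by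
    have h3 := vertMid_PhiZero b
    rw [hb, ← h] at h3
    simp only [vertMid, PhiZero, LinearMap.neg_apply, LinearMap.comp_apply, LinearMap.fst_apply,
      LinearMap.prod_apply, neg_neg] at h3
    rw [MF, LinearMap.mem_ker, map_add, ← h3]
    simp
  refine ⟨(⟨_, hm⟩, y.2 + (psiD b - b)), ?_⟩
  simp [PsiMF, Psi, phiF_apply, psiD_psiD]
  abel

theorem psiTwo_sub (b : B) : ∃ c : B, psiTwo b - b = 3 * c := by
  have h : (Ideal.Quotient.mkₐ Z3 (Ideal.span {(3 : B)})).comp psiTwo =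
      Ideal.Quotient.mkₐ Z3 (Ideal.span {(3 : B)}) := by
    apply algHom_B_ext <;>
      simp only [AlgHom.comp_apply, Ideal.Quotient.mkₐ_eq_mk, Ideal.Quotient.mk_eq_mk_iff_sub_mem,
        psiTwo, liftB_q2, liftB_q4, Ideal.mem_span_singleton]
    · exact ⟨q2, by ring⟩
    · exact ⟨5 * q4, by ring⟩
  have h2 := DFunLike.congr_fun h b
  simp only [AlgHom.comp_apply, Ideal.Quotient.mkₐ_eq_mk, Ideal.Quotient.mk_eq_mk_iff_sub_mem,
    Ideal.mem_span_singleton] at h2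
  exact h2

theorem three_ne_zero_Z3 : (3 : Z3) ≠ 0 := by
  have hi : Function.Injective (algebraMap ℤ Z3) :=
    IsLocalization.injective Z3 (Ideal.primeCompl_le_nonZeroDivisors (Ideal.span {(3 : ℤ)}))
  have := (map_ne_zero_iff _ hi).2 (show (3 : ℤ) ≠ 0 by norm_num)
  simpa using this

theorem deltaPoly_ne_zero : deltaPoly ≠ 0 := by
  intro h
  have h1 := congrArg (MvPolynomial.aeval (R := Z3) ![(0 : Z3), 1]) h
  simp [deltaPoly] at h1
  exact (isUnit_int 64 (by norm_num)).ne_zero (by exact_mod_cast h1)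

instance : IsDomain B :=
  IsLocalization.isDomain_localization (powers_le_nonZeroDivisors_of_noZeroDivisors
    deltaPoly_ne_zero)

theorem three_ne_zero_B : (3 : B) ≠ 0 := by
  have hi : Function.Injective (algebraMap (MvPolynomial (Fin 2) Z3) B) :=
    IsLocalization.injective B (powers_le_nonZeroDivisors_of_noZeroDivisors deltaPoly_ne_zero)
  have h3 : (3 : MvPolynomial (Fin 2) Z3) ≠ 0 := by
    intro h
    have := congrArg (MvPolynomial.aeval (R := Z3) ![(0 : Z3), 1]) h
    simp at this
    exact three_ne_zero_Z3 this
  have := (map_ne_zero_iff _ hi).2 h3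
  simpa only [map_ofNat] using this

theorem rPoly_natDegree : rPoly.natDegree = 3 := by
  unfold rPoly; compute_degree!

theorem rPoly_monic : rPoly.Monic := by
  unfold rPoly; monicity!

/-- The basis `1, r, r²` of `Γ` over `B`. -/
def basisGam : Module.Basis (Fin 3) B Gam :=
  (AdjoinRoot.powerBasis' rPoly_monic).basis.reindex (finCongr rPoly_natDegree)

theorem basisGam_apply (i : Fin 3) : basisGam i = r ^ (i : ℕ) := by
  simp only [basisGam, Module.Basis.reindex_apply, PowerBasis.coe_basis,
    AdjoinRoot.powerBasis'_gen, r]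
  rfl

theorem exists_coeff (z : Gam) : ∃ b0 b1 b2 : B,
    z = etaL b0 + etaL b1 * r + etaL b2 * r ^ 2 := by
  refine ⟨basisGam.repr z 0, basisGam.repr z 1, basisGam.repr z 2, ?_⟩
  conv_lhs => rw [← basisGam.sum_repr z]
  simp [Fin.sum_univ_three, basisGam_apply, Algebra.smul_def, etaL]

theorem three_mul_Gam (z : Gam) (h : 3 * z = 0) : z = 0 := by
  have h3 : (3 : B) • z = 0 := by rw [Algebra.smul_def, map_ofNat, h]
  have : basisGam.repr z = 0 := by
    have h4 := congrArg basisGam.repr h3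
    ext i
    have h5 := DFunLike.congr_fun h4 i
    simp at h5
    simpa using h5.resolve_left three_ne_zero_B
  simpa using this

theorem tensor_coeff (x0 x1 x2 : Gam)
    (h : inclL x0 + inclL x1 * inclR r + inclL x2 * inclR r ^ 2 = 0) :
    x0 = 0 ∧ x1 = 0 ∧ x2 = 0 := by
  have hli := (Algebra.TensorProduct.basis GamR basisGam).linearIndependent
  rw [Fintype.linearIndependent_iff] at hli
  have := hli ![x0, x1, x2] (by
    rw [Fin.sum_univ_three]
    simp only [Algebra.TensorProduct.basis_apply, basisGam_apply, TensorProduct.smul_tmul']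
    convert h using 1
    have e (x y : Gam) : inclL x * inclR y = (show GamR from x) ⊗ₜ[B] y := by
      change (show GamR from x) ⊗ₜ[B] (1 : Gam) * (1 : GamR) ⊗ₜ[B] y = _
      rw [Algebra.TensorProduct.tmul_mul_tmul, mul_one, one_mul]
    rw [← map_pow, e, e, ← mul_one (inclL x0), ← map_one inclR, e]
    simp only [smul_eq_mul, mul_one]
    simp)
  exact ⟨this 0, this 1, this 2⟩

theorem counit_rel : Polynomial.eval₂ (AlgHom.id Z3 B : B →ₐ[Z3] B) (0 : B) rPoly = 0 := by
  simp [rPoly]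

/-- The counit `Γ → B`, `r ↦ 0`. -/
def counit : Gam →ₐ[Z3] B := AdjoinRoot.liftAlgHom rPoly (AlgHom.id Z3 B) 0 counit_rel

theorem counit_etaL (b : B) : counit (etaL b) = b := AdjoinRoot.lift_of counit_rel
theorem counit_r : counit r = 0 := AdjoinRoot.lift_root counit_rel

theorem cocycle_coeff (b0 b1 b2 : B)
    (h : cobarOne (etaL b0 + etaL b1 * r + etaL b2 * r ^ 2) = 0) :
    b0 = 0 ∧ etaR b1 = etaL b1 + 2 * etaL b2 * r ∧ etaR b2 = etaL b2 := by
  have h1 := tensor_coeff (etaR b0) (etaR b1 - etaL b1 - 2 * etaL b2 * r) (etaR b2 - etaL b2) (by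
    rw [← h]
    simp only [cobarOne, LinearMap.add_apply, LinearMap.sub_apply, AlgHom.toLinearMap_apply,
      map_add, map_mul, map_pow, map_sub, map_ofNat, coprod_etaL, coprod_r, incl_balanced]
    ring)
  obtain ⟨h0, h1, h2⟩ := h1
  refine ⟨?_, by linear_combination h1, by linear_combination h2⟩
  have hinj : Function.Injective etaR := by
    refine Function.LeftInverse.injective (g := counit) fun b => ?_
    have : counit.comp etaR = AlgHom.id Z3 B := by
      apply algHom_B_ext <;>
        simp [etaR_q2, etaR_q4, counit_etaL, counit_r, map_ofNat]
    exact DFunLike.congr_fun this b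
  exact hinj (by rw [h0, map_zero])

/-- `Φ` is zero on `Ext¹`, so that `E₂^{0,1}` is all of `Ext¹`. -/
theorem PhiOne_cocycle (z : Gam) (hz : cobarOne z = 0) : ∃ y : B × B, vertMid y = PhiOne z := by
  obtain ⟨b0, b1, b2, rfl⟩ := exists_coeff z
  obtain ⟨rfl, h1, h2⟩ := cocycle_coeff b0 b1 b2 hz
  obtain ⟨e1, he1⟩ := psiTwo_sub b1
  obtain ⟨e2, he2⟩ := psiTwo_sub b2
  have hp1 : psiTwo b1 = b1 + 3 * e1 := by linear_combination he1
  have hp2 : psiTwo b2 = b2 + 3 * e2 := by linear_combination he2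
  have g1 := psiTwoGam_etaR b1
  have g2 := psiTwoGam_etaR b2
  simp only [psiTwoGam_etaL, psiTwoGam_r, map_add, map_mul, map_ofNat, hp1, hp2,
    h1, h2] at g1 g2
  have k2 : etaR e2 = etaL e2 := by
    have := three_mul_Gam (etaR e2 - etaL e2) (by linear_combination -g2)
    linear_combination this
  have k1 : etaR e1 = etaL e1 + 2 * (etaL b2 + 4 * etaL e2) * r := by
    have := three_mul_Gam (etaR e1 - etaL e1 - 2 * (etaL b2 + 4 * etaL e2) * r)
      (by linear_combination -g1)
    linear_combination this
  refine ⟨(q4 * (5 * b2 + 16 * e2) - q2 * (b1 + 4 * e1), 0), ?_⟩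
  simp only [vertMid, PhiOne, cobarZero, LinearMap.neg_apply, LinearMap.comp_apply,
    LinearMap.fst_apply, LinearMap.sub_apply, AlgHom.toLinearMap_apply, LinearMap.id_apply,
    map_add, map_sub, map_mul, map_pow, map_ofNat, map_zero, psiTwoGam_etaL, psiTwoGam_r,
    hp1, hp2, h1, h2, k1, k2, etaR_q2, etaR_q4]
  ring

theorem zigzag_total (x : Ext1) : ∃ w : H2C, (x, w) ∈ zigzag := by
  obtain ⟨z, rfl⟩ := Submodule.Quotient.mk_surjective _ x
  obtain ⟨y, hy⟩ := PhiOne_cocycle z z.2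
  exact ⟨_, z, y, hy, rfl, rfl⟩

theorem zigzag_existsUnique (x : Ext1) : ∃! w : H2C, (x, w) ∈ zigzag := by
  obtain ⟨w, hw⟩ := zigzag_total x
  refine ⟨w, hw, fun w' hw' => ?_⟩
  have := zigzag_functional _ (zigzag.sub_mem hw' hw) (by simp)
  exact sub_eq_zero.1 this

/-- The differential `d̃ = d₂ : Ext¹ → coker Ψ`: `d̃[z] = [Ψ(y)]` for any `y ∈ B ⊕ B` with
`(-d ⊕ 0)(y) = Φ(z)`. -/
def dTilde : Ext1 →ₗ[Z3] H2C where
  toFun x := (zigzag_existsUnique x).choose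
  map_add' x x' := ((zigzag_existsUnique (x + x')).choose_spec.2 _ (zigzag.add_mem
    (zigzag_existsUnique x).choose_spec.1 (zigzag_existsUnique x').choose_spec.1)).symm
  map_smul' c x := ((zigzag_existsUnique (c • x)).choose_spec.2 _ (zigzag.smul_mem c
    (zigzag_existsUnique x).choose_spec.1)).symm

theorem dTilde_mk (z : LinearMap.ker cobarOne) (y : B × B) (h : vertMid y = PhiOne z) :
    dTilde (Submodule.Quotient.mk z) = Submodule.Quotient.mk (Psi y) :=
  ((zigzag_existsUnique _).choose_spec.2 _ ⟨z, y, h, rfl, rfl⟩).symm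

/-- `Δ` as a unit of `B`. -/
def DeltaU : Bˣ := isUnit_Delta.unit

/-- `s = 8q₄`, a unit of `B`. -/
def sU : Bˣ := (show IsUnit (8 * q4) by
  simpa using (isUnit_int_alg 8 (by norm_num)).mul isUnit_q4).unit

/-- `t = μ/8 = 2q₂² - 8q₄`, a unit of `B`. -/
def tU : Bˣ := (show IsUnit (2 * q2 ^ 2 - 8 * q4) by
  refine isUnit_of_dvd_unit ⟨8, ?_⟩ isUnit_mu
  rw [mu]; ring).unit

theorem etaR_DeltaU_zpow (k : ℤ) : etaR ((DeltaU ^ k : Bˣ) : B) = etaL ((DeltaU ^ k : Bˣ) : B) := by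
  have h : Units.map (etaR : B →* Gam) DeltaU = Units.map (etaL : B →* Gam) DeltaU :=
    Units.ext etaR_Delta
  have h2 := congrArg (fun u : Gamˣ => ((u ^ k : Gamˣ) : Gam)) h
  simp only [← map_zpow, Units.coe_map] at h2
  exact h2

theorem cobarOne_Delta_r (k : ℤ) : cobarOne (etaL ((DeltaU ^ k : Bˣ) : B) * r) = 0 := by
  simp only [cobarOne, LinearMap.add_apply, LinearMap.sub_apply, AlgHom.toLinearMap_apply,
    map_mul, coprod_etaL, coprod_r, incl_balanced, etaR_DeltaU_zpow]
  ring

theorem cobarOne_r : cobarOne r = 0 := by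
  simpa using cobarOne_Delta_r 0

/-- `α ∈ Ext¹`, the class of `r ∈ Γ`. -/
def alpha : Ext1 := Submodule.Quotient.mk ⟨r, cobarOne_r⟩

/-- `Δ^k α ∈ Ext¹`, the class of `Δ^k r ∈ Γ`. -/
def deltaAlpha (k : ℤ) : Ext1 :=
  Submodule.Quotient.mk ⟨etaL ((DeltaU ^ k : Bˣ) : B) * r, cobarOne_Delta_r k⟩

/-- `a_{i,j} = s^i t^j - s^j t^i`. -/
def aElt (i j : ℤ) : B := ((sU ^ i * tU ^ j : Bˣ) : B) - ((sU ^ j * tU ^ i : Bˣ) : B)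

/-- `b_{i,j} = a_{i,j} q₂`. -/
def bElt (i j : ℤ) : B := aElt i j * q2

/-- `B^m_v = b_{i,j}` with `i = ⌊(m-1)/2⌋ - v` and `j = ⌈(m+1)/2⌉ + v`. -/
def BElt (m v : ℤ) : B := bElt (⌊((m : ℚ) - 1) / 2⌋ - v) (⌈((m : ℚ) + 1) / 2⌉ + v)

/-- The class of `B^m_v` in `H²(C^*) = coker Ψ`. -/
def BClass (m v : ℤ) : H2C := Submodule.Quotient.mk (BElt m v)

/-- The index `v` attached to `k ≠ 0`: `⌊(3k-1)/2⌋ - k` for `k > 0` and `⌊(3k-1)/2⌋ - 2k` for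
`k < 0`. -/
def vIndex (k : ℤ) : ℤ := ⌊(3 * (k : ℚ) - 1) / 2⌋ - if 0 < k then k else 2 * k

/-- `ℤ/3^n` as a `ℤ_(3)`-module. -/
abbrev ZModThreePow (n : ℕ) : Type := Z3 ⧸ Ideal.span {(3 : Z3) ^ n}

end QTwo

end

noncomputable section

namespace QTwo

/-! Everything reduces to the classes of `Δ^k q₂` in coker Ψ, written `cls k`.

`Ext1` is spanned over ℤ_(3) by the classes Δ^kα (`exists_of_cocycle`). Over S = ℤ_(3)[q₂, Δ^±1] the
ring `B` is spanned by 1, q₄, q₄², and d is divisible by 3 on S. A cocycle b₁r + b₂r² can therefore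
be changed by d(f q₄²) and d(f q₄), f in S, until only Σ cₙΔⁿr plus a multiple of 3 is left; a
cocycle divisible by 3 is a coboundary.

Since ψ_[2] multiplies Δ by 4096 ≡ 1 mod 9, Φ(Δ^k r) is a unit times 3Δ^k r = d(Δ^k q₂), so d̃(Δ^kα)
is a unit times `cls k` (`dTilde_deltaAlpha`). In coker Ψ one has ψ_d(y) = -y. This gives `cls 0 =
0`, and, because s²t = 8Δ and 8st² = ψ_d(Δ), it makes the class of B^{3k}_v a unit times `cls k` for
k ≠ 0 (`BClass_eq`).

It remains to see that the `cls k`, k ≠ 0, are independent over ℤ/3 (`dvd_of_sum_mem_range`). Modulo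
3, 1 - ψ_d kills ψ_d(y) + y because ψ_d² = ψ_[2] ≡ 1, and an invariant x is congruent to an element
of S without terms Δⁿq₂. Modulo 3, ψ_d fixes q₂, while Δⁿ - ψ_d(Δⁿ) has order min(n, 2n) at q₄ = 0.
These orders are distinct for n ≠ 0, so all coefficients vanish modulo 3. -/

theorem valuation_eq_zero_of_sum_eq_zero {L Γ₀ ι : Type*} [Field L]
    [LinearOrderedCommGroupWithZero Γ₀] (v : Valuation L Γ₀) (s : Finset ι) (f : ι → L)
    (hv : ∀ i ∈ s, ∀ j ∈ s, f i ≠ 0 → f j ≠ 0 → v (f i) = v (f j) → i = j)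
    (h : ∑ i ∈ s, f i = 0) : ∀ i ∈ s, f i = 0 := by
  classical
  by_contra! hne
  obtain ⟨i, hi, hfi⟩ := hne
  -- The nonzero term of largest valuation strictly dominates all others, so the sum inherits its
  -- valuation and cannot vanish.
  obtain ⟨j, hj, hmax⟩ := (s.filter fun i => f i ≠ 0).exists_max_image (fun i => v (f i))
    ⟨i, by simp [hi, hfi]⟩
  simp only [Finset.mem_filter] at hj hmax
  have := v.map_sum_eq_of_lt (f := f) hj.1 (fun l hl => by
    simp only [Finset.mem_sdiff, Finset.mem_singleton] at hl
    by_cases hl0 : f l = 0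
    · simpa [hl0, zero_lt_iff] using hj.2
    · exact lt_of_le_of_ne (hmax l ⟨hl.1, hl0⟩) fun he => hl.2 (hv l hl.1 j hj.1 hl0 hj.2 he))
  rw [h, map_zero] at this
  exact hj.2 ((v.zero_iff).1 this.symm)

/-! ### Reductions of `B` to rational function fields of characteristic 3 -/

section RatFunc
variable (K : Type) [Field K]

/-- The valuation of `K(X)` at `X = 0`. -/
abbrev valX : Valuation (RatFunc K) (WithZero (Multiplicative ℤ)) :=
  (Polynomial.idealX K).valuation (RatFunc K)

theorem valX_X : valX K RatFunc.X = WithZero.exp (-1 : ℤ) :=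
  Polynomial.valuation_X_eq_neg_one K

variable {K}

theorem valX_C {c : K} (hc : c ≠ 0) : valX K (RatFunc.C c) = 1 := by
  have h (c : K) : valX K (RatFunc.C c) ≤ 1 := by
    rw [← RatFunc.algebraMap_C]
    exact (Polynomial.idealX K).valuation_le_one _
  refine le_antisymm (h c) ?_
  have h1 : valX K (RatFunc.C c) * valX K (RatFunc.C c⁻¹) = 1 := by
    rw [← map_mul, ← map_mul, mul_inv_cancel₀ hc, map_one, map_one]
  calc (1 : WithZero (Multiplicative ℤ)) = _ := h1.symm
    _ ≤ valX K (RatFunc.C c) * 1 := by gcongr; exact h _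
    _ = _ := mul_one _

theorem valX_sq_sub_X {c : K} (hc : c ≠ 0) : valX K (RatFunc.C c ^ 2 - RatFunc.X) = 1 := by
  have h : valX K (RatFunc.C c ^ 2) = 1 := by rw [map_pow, valX_C hc, one_pow]
  rw [Valuation.map_sub_eq_of_lt_left _ (by
    rw [h, valX_X, ← WithZero.exp_zero, WithZero.exp_lt_exp]; norm_num), h]

theorem sq_sub_X_ne_zero (c : K) : RatFunc.C c ^ 2 - RatFunc.X ≠ 0 := by
  rcases eq_or_ne c 0 with rfl | hc
  · simp [RatFunc.X_ne_zero]
  · intro h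
    have := valX_sq_sub_X hc
    simp [h] at this

theorem disc_ne_zero (h3 : (3 : K) = 0) (c : K) :
    (RatFunc.X : RatFunc K) ^ 2 * (16 * RatFunc.C c ^ 2 - 64 * RatFunc.X) ≠ 0 := by
  have h : (3 : RatFunc K) = 0 := by rw [← map_ofNat RatFunc.C, h3, map_zero]
  rw [show (16 * RatFunc.C c ^ 2 - 64 * RatFunc.X : RatFunc K) = RatFunc.C c ^ 2 - RatFunc.X by
    linear_combination (5 * RatFunc.C c ^ 2 - 21 * RatFunc.X) * h]
  exact mul_ne_zero (pow_ne_zero _ RatFunc.X_ne_zero) (sq_sub_X_ne_zero c)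

variable [Algebra Z3 K]

/-- The map `B → K(X)`, `q₂ ↦ c`, `q₄ ↦ X`, for a field `K` of characteristic `3`. -/
def redB (h3 : (3 : K) = 0) (c : K) : B →ₐ[Z3] RatFunc K :=
  liftB (RatFunc.C c) RatFunc.X (disc_ne_zero h3 c).isUnit

variable (h3 : (3 : K) = 0) (c : K)

theorem redB_q2 : redB h3 c q2 = RatFunc.C c := liftB_q2 ..
theorem redB_q4 : redB h3 c q4 = RatFunc.X := liftB_q4 ..

theorem redB_three : redB h3 c 3 = 0 := by
  rw [map_ofNat, ← map_ofNat RatFunc.C, h3, map_zero]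

theorem redB_mu : redB h3 c mu = RatFunc.C c ^ 2 - RatFunc.X := by
  have h := redB_three h3 c
  rw [map_ofNat] at h
  simp only [mu, map_sub, map_mul, map_pow, map_ofNat, redB_q2, redB_q4]
  linear_combination (5 * RatFunc.C c ^ 2 - 21 * RatFunc.X) * h

theorem redB_Delta : redB h3 c Delta = RatFunc.X ^ 2 * (RatFunc.C c ^ 2 - RatFunc.X) := by
  rw [Delta, map_mul, map_pow, redB_mu, redB_q4]

theorem redB_psiD_Delta : redB h3 c (psiD Delta) =
    RatFunc.X * (RatFunc.C c ^ 2 - RatFunc.X) ^ 2 := by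
  have h := redB_three h3 c
  rw [map_ofNat] at h
  simp only [Delta, mu, psiD, map_sub, map_mul, map_pow, map_ofNat, liftB_q2, liftB_q4, redB_q2,
    redB_q4, map_neg]
  have e : ∀ x y : RatFunc K, (x ^ 2 - 4 * y) ^ 2 * (16 * (-2 * x) ^ 2 - 64 * (x ^ 2 - 4 * y)) =
    256 * (y * (x ^ 2 - 4 * y) ^ 2) := fun x y => by ring
  rw [e]
  have h4 : (RatFunc.C c ^ 2 - 4 * RatFunc.X : RatFunc K) = RatFunc.C c ^ 2 - RatFunc.X := by
    linear_combination -RatFunc.X * h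
  rw [h4]
  linear_combination 85 * (RatFunc.X * (RatFunc.C c ^ 2 - RatFunc.X) ^ 2) * h

end RatFunc

/-! ### Divisibility by 3 in ℤ_(3) and in `B` -/

/-- The residue field of `ℤ_(3)`. -/
abbrev Kap : Type := IsLocalRing.ResidueField Z3

theorem maximalIdeal_Z3 : IsLocalRing.maximalIdeal Z3 = Ideal.span {3} := by
  rw [← Localization.AtPrime.map_eq_maximalIdeal, Ideal.map_span]
  simp

theorem algebraMap_Kap_eq_zero (c : Z3) : algebraMap Z3 Kap c = 0 ↔ 3 ∣ c := by
  rw [← Ideal.mem_span_singleton, ← maximalIdeal_Z3]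
  exact IsLocalRing.residue_eq_zero_iff c

theorem three_Kap : (3 : Kap) = 0 := by
  rw [← map_ofNat (algebraMap Z3 Kap), algebraMap_Kap_eq_zero]

theorem prime_three_Z3 : Prime (3 : Z3) := by
  rw [← Ideal.span_singleton_prime three_ne_zero_Z3, ← maximalIdeal_Z3]
  infer_instance

theorem isUnit_of_sub_one {c : Z3} (h : 3 ∣ c - 1) : IsUnit c := by
  by_contra hc
  have : c ∈ IsLocalRing.maximalIdeal Z3 := hc
  rw [maximalIdeal_Z3, Ideal.mem_span_singleton] at this
  exact prime_three_Z3.not_isUnit (isUnit_of_dvd_one ((dvd_sub_right this).1 h))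

theorem isUnit_of_add_one {c : Z3} (h : 3 ∣ c + 1) : IsUnit c :=
  IsUnit.neg_iff c |>.1 (isUnit_of_sub_one (by
    rw [show -c - 1 = -(c + 1) by ring]; exact (dvd_neg).2 h))

/-- The prime 3 of the polynomial ring survives inverting Δ because 3 does not divide Δ: the
reduction `redB` kills 3 but not the unit Δ. -/
theorem prime_three_B : Prime (3 : B) := by
  have hp : Prime (3 : MvPolynomial (Fin 2) Z3) := by
    rw [← map_ofNat MvPolynomial.C]
    exact (MvPolynomial.prime_C_iff _).2 prime_three_Z3
  rw [← Ideal.span_singleton_prime three_ne_zero_B]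
  have := IsLocalization.isPrime_of_isPrime_disjoint (Submonoid.powers deltaPoly) B
    (Ideal.span {3}) ((Ideal.span_singleton_prime hp.ne_zero).2 hp) (by
      rw [Set.disjoint_left]
      rintro _ ⟨n, rfl⟩ hn
      have h := Ideal.mem_span_singleton.1 hn
      have h1 := (map_dvd (algebraMap _ B) (hp.dvd_of_dvd_pow h))
      rw [algebraMap_deltaPoly, map_ofNat] at h1
      have h2 := map_dvd (redB three_Kap 0) h1
      rw [redB_three, zero_dvd_iff] at h2
      exact (isUnit_Delta.map (redB three_Kap 0)).ne_zero h2)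
  rwa [Ideal.map_span, Set.image_singleton, map_ofNat] at this

theorem redB_eq_zero {K : Type} [Field K] [Algebra Z3 K] (h3 : (3 : K) = 0) (c : K) {b : B}
    (h : 3 ∣ b) : redB h3 c b = 0 := by
  obtain ⟨a, rfl⟩ := h
  rw [map_mul, redB_three, zero_mul]

theorem three_not_dvd_q2 : ¬ (3 : B) ∣ q2 := fun h => by
  have := redB_eq_zero (three_Kap) 1 h
  rw [redB_q2] at this
  simp at this

theorem three_dvd_of_q2_mul {b : B} (h : 3 ∣ q2 * b) : 3 ∣ b :=
  (prime_three_B.dvd_or_dvd h).resolve_left three_not_dvd_q2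

/-! ### Decomposition of `B` over ℤ_(3)[q₂, Δ^±1] -/

/-- `Δ^n` for an integer `n`. -/
abbrev DeltaZ (n : ℤ) : B := ((DeltaU ^ n : Bˣ) : B)

theorem DeltaZ_zero : DeltaZ 0 = 1 := by rw [DeltaZ, zpow_zero, Units.val_one]
theorem DeltaZ_one : DeltaZ 1 = Delta := by rw [DeltaZ, zpow_one]; rfl
theorem DeltaZ_mul (m n : ℤ) : DeltaZ m * DeltaZ n = DeltaZ (m + n) := by
  simp [DeltaZ, zpow_add]

theorem etaR_DeltaZ (n : ℤ) : etaR (DeltaZ n) = etaL (DeltaZ n) := etaR_DeltaU_zpow n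

/-- The map from finitely supported families `p` of polynomials to `B`,
`p ↦ ∑ n, p_n(q₂) Δ^n`. -/
def sig : (ℤ →₀ Polynomial Z3) →ₗ[Z3] B :=
  Finsupp.lsum Z3 fun n =>
    LinearMap.mulRight Z3 (DeltaZ n) ∘ₗ (Polynomial.aeval (R := Z3) q2).toLinearMap

theorem sig_apply (F : ℤ →₀ Polynomial Z3) :
    sig F = F.sum fun n p => Polynomial.aeval q2 p * DeltaZ n := by
  rfl

theorem sig_single (n : ℤ) (p : Polynomial Z3) :
    sig (Finsupp.single n p) = Polynomial.aeval q2 p * DeltaZ n := by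
  rw [sig_apply, Finsupp.sum_single_index (by simp)]

/-- The subring `ℤ_(3)[q₂, Δ, Δ⁻¹]` of `B`, as a submodule. -/
def SS : Submodule Z3 B := LinearMap.range sig

theorem SS_induction {P : B → Prop} {f : B} (hf : f ∈ SS) (h0 : P 0)
    (hadd : ∀ x y, P x → P y → P (x + y))
    (h : ∀ n (p : Polynomial Z3), P (Polynomial.aeval q2 p * DeltaZ n)) : P f := by
  obtain ⟨F, rfl⟩ := hf
  induction F using Finsupp.induction_linear with
  | zero => simpa using h0
  | add F G hF hG => rw [map_add]; exact hadd _ _ hF hG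
  | single n p => rw [sig_single]; exact h n p

theorem aeval_mul_DeltaZ_mem (n : ℤ) (p : Polynomial Z3) :
    Polynomial.aeval q2 p * DeltaZ n ∈ SS := ⟨_, sig_single n p⟩

theorem algebraMap_mem_SS (c : Z3) : algebraMap Z3 B c ∈ SS := by
  simpa [DeltaZ_zero] using aeval_mul_DeltaZ_mem 0 (Polynomial.C c)

theorem q2_mul_mem {f : B} (hf : f ∈ SS) : q2 * f ∈ SS := by
  refine SS_induction (P := fun f => q2 * f ∈ SS) hf (by simp)
    (fun x y hx hy => by rw [mul_add]; exact SS.add_mem hx hy) fun n p => ?_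
  have := aeval_mul_DeltaZ_mem n (Polynomial.X * p)
  rwa [map_mul, Polynomial.aeval_X, mul_assoc] at this

theorem DeltaZ_mul_mem (k : ℤ) {f : B} (hf : f ∈ SS) : DeltaZ k * f ∈ SS := by
  refine SS_induction (P := fun f => DeltaZ k * f ∈ SS) hf (by simp)
    (fun x y hx hy => by rw [mul_add]; exact SS.add_mem hx hy) fun n p => ?_
  have := aeval_mul_DeltaZ_mem (k + n) p
  rwa [← DeltaZ_mul, mul_left_comm] at this

theorem exists_inv_sixtyFour : ∃ i : Z3, 64 * i = 1 := by
  have h := isUnit_int 64 (by norm_num)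
  obtain ⟨i, hi⟩ := h.exists_right_inv
  exact ⟨i, by exact_mod_cast hi⟩

/-- The relation 64q₄³ = 16q₂²q₄² - Δ, with 64 invertible, reduces every power of q₄ to 1, q₄, q₄²;
denominators are powers of Δ, which lie in `SS`. -/
theorem exists_decomp (b : B) :
    ∃ f0 ∈ SS, ∃ f1 ∈ SS, ∃ f2 ∈ SS, b = f0 + f1 * q4 + f2 * q4 ^ 2 := by
  have hpoly (p : MvPolynomial (Fin 2) Z3) : ∃ f0 ∈ SS, ∃ f1 ∈ SS, ∃ f2 ∈ SS,
      algebraMap _ B p = f0 + f1 * q4 + f2 * q4 ^ 2 := by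
    induction p using MvPolynomial.induction_on with
    | C a =>
      refine ⟨_, algebraMap_mem_SS a, 0, SS.zero_mem, 0, SS.zero_mem, ?_⟩
      rw [← MvPolynomial.algebraMap_eq, ← IsScalarTower.algebraMap_apply]
      ring
    | add p q hp hq =>
      obtain ⟨f0, h0, f1, h1, f2, h2, e⟩ := hp
      obtain ⟨g0, k0, g1, k1, g2, k2, e'⟩ := hq
      exact ⟨_, SS.add_mem h0 k0, _, SS.add_mem h1 k1, _, SS.add_mem h2 k2, by
        rw [map_add, e, e']; ring⟩
    | mul_X p i hp =>
      obtain ⟨f0, h0, f1, h1, f2, h2, e⟩ := hp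
      rw [map_mul, e]
      fin_cases i
      · exact ⟨_, q2_mul_mem h0, _, q2_mul_mem h1, _, q2_mul_mem h2, by
          change _ * q2 = _
          ring⟩
      · obtain ⟨i, hi⟩ := exists_inv_sixtyFour
        have hi' := congrArg (algebraMap Z3 B) hi
        rw [map_mul, map_ofNat, map_one] at hi'
        have hD : Delta = q4 ^ 2 * (16 * q2 ^ 2 - 64 * q4) := rfl
        refine ⟨_, SS.smul_mem (-i) (DeltaZ_mul_mem 1 h2), _, h0, _,
          SS.add_mem h1 (SS.smul_mem (16 * i) (q2_mul_mem (q2_mul_mem h2))), ?_⟩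
        change _ * q4 = _
        rw [Algebra.smul_def, Algebra.smul_def, DeltaZ_one, map_neg, map_mul, map_ofNat, hD]
        linear_combination (-f2 * q4 ^ 3) * hi'
  obtain ⟨⟨p, ⟨_, n, rfl⟩⟩, hp⟩ := IsLocalization.surj (Submonoid.powers deltaPoly) b
  obtain ⟨f0, h0, f1, h1, f2, h2, e⟩ := hpoly p
  simp only [map_pow, algebraMap_deltaPoly] at hp
  have hb : b = DeltaZ (-n) * (b * Delta ^ n) := by
    have : DeltaZ (-n) * Delta ^ n = 1 := by
      rw [← DeltaZ_one, DeltaZ, DeltaZ, zpow_one, ← Units.val_pow_eq_pow_val, ← Units.val_mul]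
      simp
    linear_combination -b * this
  refine ⟨_, DeltaZ_mul_mem (-n) h0, _, DeltaZ_mul_mem (-n) h1, _, DeltaZ_mul_mem (-n) h2, ?_⟩
  rw [hb, hp, e]
  ring

/-! ### The cobar differential modulo 3 and modulo (3, q₂) -/

/-- The part of `∑ n, p_n(q₂) Δ^n` linear in `q₂`, divided by `q₂`. -/
def lin (F : ℤ →₀ Polynomial Z3) : B :=
  F.sum fun n p => algebraMap Z3 B (p.coeff 1) * DeltaZ n

theorem cobarZero_apply (b : B) : cobarZero b = etaR b - etaL b := rfl

theorem etaR_algebraMap (c : Z3) : etaR (algebraMap Z3 B c) = etaL (algebraMap Z3 B c) := by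
  rw [AlgHom.commutes, AlgHom.commutes]

theorem exists_etaR_aeval (p : Polynomial Z3) : ∃ u : Gam,
    etaR (Polynomial.aeval q2 p) = etaL (Polynomial.aeval q2 p) + 3 * u := by
  induction p using Polynomial.induction_on' with
  | add p q hp hq =>
    obtain ⟨u, hu⟩ := hp
    obtain ⟨v, hv⟩ := hq
    exact ⟨u + v, by simp only [map_add, hu, hv]; ring⟩
  | monomial n a =>
    obtain ⟨u, hu⟩ := sub_dvd_pow_sub_pow (etaL q2 + 3 * r) (etaL q2) n
    refine ⟨etaL (algebraMap Z3 B a) * (r * u), ?_⟩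
    rw [Polynomial.aeval_monomial, map_mul, map_mul, etaR_algebraMap, map_pow, map_pow, etaR_q2]
    linear_combination etaL (algebraMap Z3 B a) * hu

theorem exists_cobarZero_of_mem {f : B} (hf : f ∈ SS) : ∃ u : Gam, etaR f = etaL f + 3 * u := by
  refine SS_induction (P := fun f => ∃ u : Gam, etaR f = etaL f + 3 * u) hf ⟨0, by simp⟩ ?_ ?_
  · rintro x y ⟨u, hu⟩ ⟨v, hv⟩
    exact ⟨u + v, by simp only [map_add, hu, hv]; ring⟩
  · intro n p
    obtain ⟨u, hu⟩ := exists_etaR_aeval p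
    exact ⟨u * etaL (DeltaZ n), by rw [map_mul, map_mul, etaR_DeltaZ, hu]; ring⟩

/-- Δⁿ is invariant and d(q₂^i) ≡ 3i q₂^(i-1) r modulo 9, so after dividing by 3 only the terms with
i = 1 survive modulo (3, q₂). -/
theorem exists_cobarZero_sig (F : ℤ →₀ Polynomial Z3) : ∃ a b : Gam,
    cobarZero (sig F) = 3 * (etaL (lin F) * r + 3 * a + etaL q2 * b) := by
  induction F using Finsupp.induction_linear with
  | zero => exact ⟨0, 0, by simp [lin]⟩
  | add F G hF hG =>
    obtain ⟨a, b, h⟩ := hF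
    obtain ⟨a', b', h'⟩ := hG
    refine ⟨a + a', b + b', ?_⟩
    have : lin (F + G) = lin F + lin G :=
      Finsupp.sum_add_index' (by simp) (by intros; simp [add_mul])
    rw [this, map_add, map_add, map_add, h, h']
    ring
  | single n p =>
    obtain ⟨u, hu⟩ := exists_etaR_aeval p.divX.divX
    have hp : Polynomial.aeval q2 p = (Polynomial.aeval q2 p.divX.divX * q2 +
        algebraMap Z3 B (p.coeff 1)) * q2 + algebraMap Z3 B (p.coeff 0) := by
      conv_lhs => rw [← Polynomial.divX_mul_X_add p, ← Polynomial.divX_mul_X_add p.divX]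
      simp [Polynomial.coeff_divX]
    have hl : lin (Finsupp.single n p) = algebraMap Z3 B (p.coeff 1) * DeltaZ n :=
      Finsupp.sum_single_index (by simp)
    set g := Polynomial.aeval q2 p.divX.divX
    refine ⟨etaL (DeltaZ n) * (r ^ 2 * etaL g + 3 * r ^ 2 * u + 2 * etaL q2 * r * u),
      etaL (DeltaZ n) * (2 * r * etaL g + etaL q2 * u), ?_⟩
    rw [sig_single, hl, cobarZero_apply, hp]
    simp only [map_mul, map_add, etaR_DeltaZ, etaR_algebraMap, etaR_q2, hu]
    ring

/-- The two units agree modulo (3, q₂), since d(q₂) = 3r and d(q₄) = 2q₂r + 3r². -/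
theorem exists_cobarZero (b : B) : ∃ u v : Gam, cobarZero b = 3 * u + etaL q2 * v := by
  let I : Ideal Gam := Ideal.span {3, etaL q2}
  have h : (Ideal.Quotient.mkₐ Z3 I).comp etaR = (Ideal.Quotient.mkₐ Z3 I).comp etaL := by
    apply algHom_B_ext <;>
      simp only [AlgHom.comp_apply, Ideal.Quotient.mkₐ_eq_mk, Ideal.Quotient.mk_eq_mk_iff_sub_mem,
        I, Ideal.mem_span_pair, etaR_q2, etaR_q4]
    · exact ⟨r, 0, by ring⟩
    · exact ⟨r ^ 2, 2 * r, by ring⟩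
  have h2 := DFunLike.congr_fun h b
  simp only [AlgHom.comp_apply, Ideal.Quotient.mkₐ_eq_mk, Ideal.Quotient.mk_eq_mk_iff_sub_mem,
    I, Ideal.mem_span_pair] at h2
  obtain ⟨u, v, h2⟩ := h2
  exact ⟨u, v, by rw [cobarZero_apply, ← h2]; ring⟩

theorem coeff_unique {b0 b1 b2 c0 c1 c2 : B}
    (h : etaL b0 + etaL b1 * r + etaL b2 * r ^ 2 = etaL c0 + etaL c1 * r + etaL c2 * r ^ 2) :
    b0 = c0 ∧ b1 = c1 ∧ b2 = c2 := by
  have hli := basisGam.linearIndependent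
  rw [Fintype.linearIndependent_iff] at hli
  have := hli ![b0 - c0, b1 - c1, b2 - c2] (by
    simp only [Fin.sum_univ_three, basisGam_apply, Algebra.smul_def]
    change etaL (b0 - c0) * r ^ 0 + etaL (b1 - c1) * r ^ 1 + etaL (b2 - c2) * r ^ 2 = 0
    simp only [map_sub]
    linear_combination h)
  exact ⟨sub_eq_zero.1 (this 0), sub_eq_zero.1 (this 1), sub_eq_zero.1 (this 2)⟩

theorem dvd_coeff {b0 b1 b2 : B} {u : Gam}
    (h : etaL b0 + etaL b1 * r + etaL b2 * r ^ 2 = 3 * u) : 3 ∣ b0 ∧ 3 ∣ b1 ∧ 3 ∣ b2 := by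
  obtain ⟨c0, c1, c2, rfl⟩ := exists_coeff u
  obtain ⟨h0, h1, h2⟩ := coeff_unique (c0 := 3 * c0) (c1 := 3 * c1) (c2 := 3 * c2) (by
    rw [h]; simp only [map_mul, map_ofNat]; ring)
  exact ⟨⟨_, h0⟩, ⟨_, h1⟩, ⟨_, h2⟩⟩

theorem coeff_mem_of_eq {b : B} {u v : Gam} (h : etaL b * r = 3 * u + etaL q2 * v) :
    ∃ x y : B, b = 3 * x + q2 * y := by
  obtain ⟨c0, c1, c2, rfl⟩ := exists_coeff u
  obtain ⟨e0, e1, e2, rfl⟩ := exists_coeff v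
  obtain ⟨h0, h1, h2⟩ := coeff_unique (b0 := 0) (b1 := b) (b2 := 0)
    (c0 := 3 * c0 + q2 * e0) (c1 := 3 * c1 + q2 * e1) (c2 := 3 * c2 + q2 * e2) (by
    simp only [map_add, map_mul, map_ofNat, map_zero]
    linear_combination h)
  exact ⟨_, _, h1⟩

theorem map_DeltaZ {L : Type} [Field L] [Algebra Z3 L] (f : B →ₐ[Z3] L) (n : ℤ) :
    f (DeltaZ n) = f Delta ^ n := by
  have h : Units.map (f : B →* L) DeltaU = Units.mk0 (f Delta) (isUnit_Delta.map f).ne_zero :=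
    Units.ext rfl
  have h2 := congrArg (fun u : Lˣ => ((u ^ n : Lˣ) : L)) h
  simp only [← map_zpow, Units.coe_map, Units.val_zpow_eq_zpow_val, Units.val_mk0] at h2
  exact h2

theorem redB_algebraMap {K : Type} [Field K] [Algebra Z3 K] (h3 : (3 : K) = 0) (x : K) (c : Z3) :
    redB h3 x (algebraMap Z3 B c) = RatFunc.C (algebraMap Z3 K c) := by
  rw [AlgHom.commutes]
  rfl

/-- Setting 3 = 0 and q₂ = 0 sends Δ to -X³, so distinct powers of Δ have distinct orders at X = 0
and are linearly independent over the residue field. -/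
theorem dvd_of_sum_mem (s : Finset ℤ) (c : ℤ → Z3) {x y : B}
    (h : ∑ n ∈ s, algebraMap Z3 B (c n) * DeltaZ n = 3 * x + q2 * y) : ∀ n ∈ s, 3 ∣ c n := by
  have h1 := congrArg (redB three_Kap 0) h
  rw [map_add, map_mul, redB_three, map_mul, redB_q2, map_zero, zero_mul, zero_mul, add_zero,
    map_sum] at h1
  have hD : redB three_Kap 0 Delta = -RatFunc.X ^ 3 := by rw [redB_Delta, map_zero]; ring
  have hv (n : ℤ) : valX Kap (redB three_Kap 0 (DeltaZ n)) = WithZero.exp (-3 * n) := by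
    rw [map_DeltaZ, map_zpow₀, hD, Valuation.map_neg, map_pow, valX_X, ← WithZero.exp_nsmul,
      ← WithZero.exp_zsmul]
    congr 1
    simp
    ring
  have h2 := valuation_eq_zero_of_sum_eq_zero (valX Kap) s _ (by
    intro m _ n _ hm hn hmn
    rw [map_mul, redB_algebraMap] at hm hn
    rw [map_mul, map_mul (redB _ _), redB_algebraMap, redB_algebraMap, map_mul, map_mul, valX_C (fun h => hm (by rw [h, map_zero, zero_mul])), valX_C (fun h => hn (by rw [h, map_zero, zero_mul])),
      hv, hv, one_mul, one_mul, WithZero.exp_inj] at hmn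
    omega) h1
  intro n hn
  have h3 := h2 n hn
  rw [map_mul, redB_algebraMap, mul_eq_zero] at h3
  rw [← algebraMap_Kap_eq_zero]
  refine (map_eq_zero RatFunc.C).1 (h3.resolve_right fun h0 => ?_)
  have := hv n
  rw [h0, map_zero] at this
  exact WithZero.exp_ne_zero this.symm

/-! ### Invariants modulo 3 and generators of Ext¹ -/

/-- Write b = f₀ + f₁q₄ + f₂q₄². Modulo 3, d(b) has r²-coefficient 4q₂²f₂, which forces 3 ∣ f₂; the
r-coefficient then gives q₂f₁ ≡ c. Used with c = 0 for invariants and with c = b₂ for a cocycle b₁r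
+ b₂r². -/
theorem decomp_mod_three {b c : B} {u : Gam} (h : etaR b = etaL b + 2 * etaL c * r + 3 * u) :
    ∃ f0 ∈ SS, ∃ f1 ∈ SS, ∃ x : B, b = f0 + f1 * q4 + 3 * x ∧ 3 ∣ q2 * f1 - c := by
  obtain ⟨f0, h0, f1, h1, f2, h2, rfl⟩ := exists_decomp b
  obtain ⟨u0, e0⟩ := exists_cobarZero_of_mem h0
  obtain ⟨u1, e1⟩ := exists_cobarZero_of_mem h1
  obtain ⟨u2, e2⟩ := exists_cobarZero_of_mem h2
  simp only [map_add, map_mul, map_pow, e0, e1, e2, etaR_q4] at h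
  obtain ⟨-, k1, k2⟩ := dvd_coeff (b0 := 0) (b1 := 2 * q2 * f1 + 4 * f2 * q4 * q2 - 2 * c)
    (b2 := q2 * (q2 * (4 * f2))) (u := u - (u0 + u1 * (etaL q4 + 2 * etaL q2 * r + 3 * r ^ 2)
      + u2 * (etaL q4 + 2 * etaL q2 * r + 3 * r ^ 2) ^ 2 + etaL f1 * r ^ 2 + etaL f2 *
      (2 * etaL q4 * r ^ 2 + 4 * etaL q2 * r ^ 3 + 3 * r ^ 4))) (by
    simp only [map_add, map_sub, map_mul, map_ofNat, map_zero]
    linear_combination h)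
  obtain ⟨x, hx⟩ := three_dvd_of_q2_mul (three_dvd_of_q2_mul k2)
  obtain ⟨y, hy⟩ := k1
  refine ⟨f0, h0, f1, h1, (x - f2) * q4 ^ 2, by linear_combination q4 ^ 2 * hx,
    ⟨q2 * f1 - c - y + x * q4 * q2, ?_⟩⟩
  linear_combination -hy + q4 * q2 * hx

/-- Dividing d(sig F + 3x) = 0 by 3 leaves `lin F` · r plus d(x), up to (3, q₂). As d(x) also lies
in (3, q₂), so does `lin F`, and `dvd_of_sum_mem` applies. -/
theorem dvd_coeff_one {F : ℤ →₀ Polynomial Z3} {x : B} (h : sig F + 3 * x ∈ MF) (n : ℤ) :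
    3 ∣ (F n).coeff 1 := by
  by_cases hn : n ∈ F.support
  · obtain ⟨a, b, hF⟩ := exists_cobarZero_sig F
    obtain ⟨u, v, hx⟩ := exists_cobarZero x
    have h3 : cobarZero (3 * x) = 3 * cobarZero x := by
      simp only [cobarZero_apply, map_mul, map_ofNat]; ring
    rw [MF, LinearMap.mem_ker, map_add, hF, h3, hx] at h
    have h1 := three_mul_Gam (etaL (lin F) * r + 3 * a + etaL q2 * b + (3 * u + etaL q2 * v))
      (by linear_combination h)
    obtain ⟨y, z, hyz⟩ := coeff_mem_of_eq (b := lin F) (u := -a - u) (v := -b - v)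
      (by linear_combination h1)
    exact dvd_of_sum_mem F.support (fun n => (F n).coeff 1) hyz n hn
  · simp [Finsupp.notMem_support_iff.1 hn]

theorem exists_of_mem_MF {x : B} (hx : x ∈ MF) : ∃ (F : ℤ →₀ Polynomial Z3) (y : B),
    x = sig F + 3 * y ∧ ∀ n, 3 ∣ (F n).coeff 1 := by
  have h : etaR x - etaL x = 0 := hx
  obtain ⟨_, ⟨F, rfl⟩, f1, -, y, rfl, h1⟩ := decomp_mod_three (b := x) (c := 0) (u := 0) (by
    rw [map_zero]; linear_combination h)
  rw [sub_zero] at h1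
  obtain ⟨a, rfl⟩ := three_dvd_of_q2_mul h1
  have e : sig F + 3 * a * q4 + 3 * y = sig F + 3 * (a * q4 + y) := by ring
  rw [e] at hx ⊢
  exact ⟨F, _, rfl, dvd_coeff_one hx⟩

theorem sig_eq (F : ℤ →₀ Polynomial Z3) : ∃ f ∈ SS,
    sig F = F.sum (fun n p => algebraMap Z3 B (p.coeff 0) * DeltaZ n) + q2 * f := by
  induction F using Finsupp.induction_linear with
  | zero => exact ⟨0, SS.zero_mem, by simp⟩
  | add F G hF hG =>
    obtain ⟨f, hf, h⟩ := hF
    obtain ⟨g, hg, h'⟩ := hG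
    refine ⟨_, SS.add_mem hf hg, ?_⟩
    rw [map_add, h, h', Finsupp.sum_add_index' (by simp) (by intros; simp [add_mul])]
    ring
  | single n p =>
    refine ⟨_, aeval_mul_DeltaZ_mem n p.divX, ?_⟩
    rw [sig_single, Finsupp.sum_single_index (by simp)]
    conv_lhs => rw [← Polynomial.divX_mul_X_add p]
    simp only [map_add, map_mul, Polynomial.aeval_X, Polynomial.aeval_C]
    ring

/-- Multiplication by `q₂` on families of polynomials. -/
def mulX (F : ℤ →₀ Polynomial Z3) : ℤ →₀ Polynomial Z3 :=
  F.mapRange (fun p => Polynomial.X * p) (by simp)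

theorem sig_mulX (F : ℤ →₀ Polynomial Z3) : sig (mulX F) = q2 * sig F := by
  rw [sig_apply, sig_apply, mulX, Finsupp.sum_mapRange_index (by simp), Finsupp.mul_sum]
  refine Finsupp.sum_congr fun n _ => ?_
  rw [map_mul, Polynomial.aeval_X, mul_assoc]

theorem mulX_coeff_one (F : ℤ →₀ Polynomial Z3) (n : ℤ) :
    (mulX F n).coeff 1 = (F n).coeff 0 := by
  simp [mulX]

/-- `Gam` and `B` have no 3-torsion, so u = u₁r + u₂r² satisfies the cocycle equations itself, and
then d(u₁q₂ - u₂q₄) = 3u. -/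
theorem exists_cobarZero_eq_three_mul {u : Gam} (h : cobarOne (3 * u) = 0) :
    ∃ b : B, 3 * u = cobarZero b := by
  obtain ⟨u0, u1, u2, rfl⟩ := exists_coeff u
  obtain ⟨h0, h1, h2⟩ := cocycle_coeff (3 * u0) (3 * u1) (3 * u2) (by
    rw [← h]; congr 1; simp only [map_mul, map_ofNat]; ring)
  simp only [map_mul, map_ofNat] at h1 h2
  have k0 : u0 = 0 := by simpa [three_ne_zero_B] using h0
  have k1 := three_mul_Gam (etaR u1 - etaL u1 - 2 * etaL u2 * r) (by linear_combination h1)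
  have k2 := three_mul_Gam (etaR u2 - etaL u2) (by linear_combination h2)
  refine ⟨u1 * q2 - u2 * q4, ?_⟩
  subst k0
  simp only [cobarZero_apply, map_sub, map_mul, etaR_q2, etaR_q4, map_zero]
  linear_combination -(etaL q2 + 3 * r) * k1 + (etaL q4 + 2 * etaL q2 * r + 3 * r ^ 2) * k2

/-- With 3 ∣ b₂, b₁ is invariant modulo 3, hence b₁ ≡ Σ cₙΔⁿ + q₂f with f in `SS`. Since d(f q₄) ≡
2q₂f r ≡ -q₂f r modulo 3, adding it removes q₂f; the rest is a cocycle divisible by 3. -/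
theorem exists_of_cocycle_of_dvd {b1 b2 : B} (hz : cobarOne (etaL b1 * r + etaL b2 * r ^ 2) = 0)
    (hb : 3 ∣ b2) : ∃ (c : ℤ →₀ Z3) (w : B), etaL b1 * r + etaL b2 * r ^ 2 =
      etaL (c.sum fun n a => algebraMap Z3 B a * DeltaZ n) * r + cobarZero w := by
  obtain ⟨-, h1, -⟩ := cocycle_coeff 0 b1 b2 (by rw [← hz, map_zero, zero_add])
  obtain ⟨e, rfl⟩ := hb
  obtain ⟨_, ⟨F, rfl⟩, f1, -, x, rfl, h⟩ := decomp_mod_three (b := b1) (c := 0)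
    (u := 2 * etaL e * r) (by
      simp only [h1, map_zero, map_mul, map_ofNat]; ring)
  rw [sub_zero] at h
  obtain ⟨a, rfl⟩ := three_dvd_of_q2_mul h
  obtain ⟨f, hf, hF⟩ := sig_eq F
  obtain ⟨u, hu⟩ := exists_cobarZero_of_mem hf
  let c : ℤ →₀ Z3 := F.mapRange (fun p => p.coeff 0) (by simp)
  have hc : c.sum (fun n a => algebraMap Z3 B a * DeltaZ n) =
      F.sum (fun n p => algebraMap Z3 B (p.coeff 0) * DeltaZ n) :=
    Finsupp.sum_mapRange_index (by simp)
  rw [← hc] at hF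
  have hcoc : cobarOne (etaL (c.sum fun n a => algebraMap Z3 B a * DeltaZ n) * r) = 0 := by
    rw [Finsupp.sum, map_sum, Finset.sum_mul, map_sum]
    refine Finset.sum_eq_zero fun n _ => ?_
    have : etaL (algebraMap Z3 B (c n) * DeltaZ n) * r = c n • (etaL (DeltaZ n) * r) := by
      rw [map_mul, AlgHom.commutes, mul_assoc, ← Algebra.smul_def]
    rw [this, map_smul, cobarOne_Delta_r, smul_zero]
  have key : etaL (sig F + 3 * a * q4 + 3 * x) * r + etaL (3 * e) * r ^ 2 =
      etaL (c.sum fun n a => algebraMap Z3 B a * DeltaZ n) * r + cobarZero (-(f * q4)) +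
      3 * (etaL (a * q4) * r + etaL x * r + etaL e * r ^ 2 + etaL q2 * etaL f * r +
        etaL f * r ^ 2 + u * (etaL q4 + 2 * etaL q2 * r + 3 * r ^ 2)) := by
    rw [hF]
    simp only [cobarZero_apply, map_neg, map_add, map_mul, map_ofNat, hu, etaR_q4]
    ring
  rw [key, map_add, map_add, hcoc, cobarOne_cobarZero, zero_add, zero_add] at hz
  obtain ⟨w, hw⟩ := exists_cobarZero_eq_three_mul hz
  exact ⟨c, -(f * q4) + w, by rw [key, hw, map_add, add_assoc]⟩

/-- The r²-coefficient satisfies b₂ ≡ q₂g modulo 3 with g in `SS`. As b₂ is invariant, it has no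
Δⁿq₂ terms modulo 3, so g ≡ q₂f and b₂ ≡ q₂²f. Subtracting d(f q₄²), whose r²-coefficient is 4q₂²f
modulo 3, reduces to the case 3 ∣ b₂. -/
theorem exists_of_cocycle {z : Gam} (hz : cobarOne z = 0) : ∃ (c : ℤ →₀ Z3) (w : B), z =
    etaL (c.sum fun n a => algebraMap Z3 B a * DeltaZ n) * r + cobarZero w := by
  obtain ⟨b0, b1, b2, rfl⟩ := exists_coeff z
  obtain ⟨rfl, h1, h2⟩ := cocycle_coeff b0 b1 b2 hz
  obtain ⟨_, -, _, ⟨G, rfl⟩, -, -, y, hy⟩ := decomp_mod_three (b := b1) (c := b2) (u := 0)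
    (by rw [h1]; ring)
  have hG : sig (mulX G) + 3 * (-y) ∈ MF := by
    have : b2 ∈ MF := by
      change etaR b2 - etaL b2 = 0
      rw [h2, sub_self]
    rwa [sig_mulX, show q2 * sig G + 3 * -y = b2 by linear_combination hy]
  obtain ⟨f, hf, hGf⟩ := sig_eq G
  have h3 : ∃ a, G.sum (fun n p => algebraMap Z3 B (p.coeff 0) * DeltaZ n) = 3 * a := by
    refine Finset.dvd_sum fun n _ => ?_
    have := dvd_coeff_one hG n
    rw [mulX_coeff_one] at this
    have h4 := map_dvd (algebraMap Z3 B) this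
    rw [map_ofNat] at h4
    exact h4.mul_right _
  obtain ⟨a, ha⟩ := h3
  rw [ha] at hGf
  obtain ⟨u, hu⟩ := exists_cobarZero_of_mem hf
  have hz' : cobarOne (etaL 0 + etaL b1 * r + etaL b2 * r ^ 2 - cobarZero (f * q4 ^ 2)) = 0 := by
    rw [map_sub, hz, cobarOne_cobarZero, sub_zero]
  obtain ⟨c0, c1, c2, hc⟩ := exists_coeff
    (etaL 0 + etaL b1 * r + etaL b2 * r ^ 2 - cobarZero (f * q4 ^ 2))
  rw [hc] at hz'
  obtain ⟨rfl, -, -⟩ := cocycle_coeff c0 c1 c2 hz'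
  rw [map_zero, zero_add] at hz'
  obtain ⟨-, -, k2⟩ := dvd_coeff (b0 := 0) (b1 := c1 - b1 + 4 * f * q2 * q4)
    (b2 := c2 - b2 + 4 * f * q2 ^ 2)
    (u := -(u * (etaL q4 + 2 * etaL q2 * r + 3 * r ^ 2) ^ 2 + etaL f *
      (2 * etaL q4 * r ^ 2 + 4 * etaL q2 * r ^ 3 + 3 * r ^ 4))) (by
      simp only [cobarZero_apply, map_mul, map_pow, hu, etaR_q4] at hc
      simp only [map_add, map_sub, map_mul, map_pow, map_ofNat, map_zero] at hc ⊢
      linear_combination -hc)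
  obtain ⟨d, hd⟩ := k2
  obtain ⟨c, w, hcw⟩ := exists_of_cocycle_of_dvd hz'
    ⟨d - f * q2 ^ 2 + q2 * a - y, by linear_combination hd - hy + q2 * hGf⟩
  refine ⟨c, w + f * q4 ^ 2, ?_⟩
  rw [map_add, ← add_assoc, ← hcw]
  linear_combination hc + map_zero etaL

theorem dvd_of_smul_r_eq {c : Z3} {b : B} (h : c • r = cobarZero b) : 3 ∣ c := by
  obtain ⟨u, v, hb⟩ := exists_cobarZero b
  obtain ⟨x, y, hxy⟩ := coeff_mem_of_eq (b := algebraMap Z3 B c) (u := u) (v := v) (by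
    rw [← hb, ← h, AlgHom.commutes, ← Algebra.smul_def])
  exact dvd_of_sum_mem {0} (fun _ => c) (x := x) (y := y) (by
    rw [Finset.sum_singleton, DeltaZ_zero, mul_one, hxy]) 0 (by simp)

/-! ### ψ_d modulo 3 and independence of the classes of Δ^k q₂ -/

theorem algebraMap_KX (c : Z3) : algebraMap Z3 (RatFunc Kap) c = RatFunc.C (algebraMap Z3 Kap c) :=
  rfl

theorem three_KX : (3 : RatFunc Kap) = 0 := by
  rw [← map_ofNat RatFunc.C, three_Kap, map_zero]

/-- The map `B → F(x)(X)`, `q₂ ↦ x`, `q₄ ↦ X`, where `F` is the residue field of `ℤ_(3)`. -/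
def rho : B →ₐ[Z3] RatFunc (RatFunc Kap) := redB three_KX RatFunc.X

/-- The image of a polynomial in `F(x)`. -/
abbrev redP (p : Polynomial Z3) : RatFunc Kap :=
  algebraMap (Polynomial Kap) (RatFunc Kap) (p.map (algebraMap Z3 Kap))

theorem rho_aeval (p : Polynomial Z3) : rho (Polynomial.aeval q2 p) = RatFunc.C (redP p) := by
  induction p using Polynomial.induction_on' with
  | add p q hp hq => simp only [map_add, hp, hq, redP, Polynomial.map_add]
  | monomial n a =>
    rw [Polynomial.aeval_monomial, map_mul, map_pow, rho, redB_q2, redB_algebraMap]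
    simp only [redP, ← Polynomial.C_mul_X_pow_eq_monomial, Polynomial.map_mul, Polynomial.map_pow,
      Polynomial.map_C, Polynomial.map_X, map_mul, map_pow, RatFunc.algebraMap_C,
      RatFunc.algebraMap_X, algebraMap_KX]

theorem rho_psiD_q2 : rho (psiD q2) = rho q2 := by
  have h := redB_three three_KX RatFunc.X
  rw [map_ofNat] at h
  rw [psiD, liftB_q2, map_mul, map_neg, map_ofNat]
  change -2 * rho q2 = rho q2
  linear_combination -rho q2 * h

theorem rho_psiD_aeval (p : Polynomial Z3) :
    rho (psiD (Polynomial.aeval q2 p)) = rho (Polynomial.aeval q2 p) := by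
  have h : rho (psiD (Polynomial.aeval q2 p)) = Polynomial.aeval (rho (psiD q2)) p := by
    rw [Polynomial.aeval_algHom_apply, Polynomial.aeval_algHom_apply]
  rw [h, rho_psiD_q2, Polynomial.aeval_algHom_apply]

theorem valX_rho_Delta : valX _ (rho Delta) = WithZero.exp (-2 : ℤ) := by
  rw [rho, redB_Delta, map_mul, map_pow, valX_sq_sub_X RatFunc.X_ne_zero, valX_X, mul_one,
    ← WithZero.exp_nsmul]
  rfl

theorem valX_rho_psiD_Delta : valX _ (rho (psiD Delta)) = WithZero.exp (-1 : ℤ) := by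
  rw [rho, redB_psiD_Delta, map_mul, map_pow, valX_sq_sub_X RatFunc.X_ne_zero, valX_X, one_pow,
    mul_one]

/-- Modulo 3, Δ = X²(x² - X) and ψ_d(Δ) = X(x² - X)², of orders 2 and 1 at X = 0. For n ≠ 0 the
orders 2n and n differ, so the smaller one is the order of the difference. -/
theorem valX_rho_DeltaZ_sub {n : ℤ} (hn : n ≠ 0) :
    valX _ (rho (DeltaZ n - psiD (DeltaZ n))) = WithZero.exp (-(min n (2 * n))) := by
  have h1 : valX _ (rho (DeltaZ n)) = WithZero.exp (-(2 * n)) := by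
    rw [map_DeltaZ, map_zpow₀, valX_rho_Delta, ← WithZero.exp_zsmul]
    congr 1; simp; ring
  have h2 : valX _ (rho (psiD (DeltaZ n))) = WithZero.exp (-n) := by
    have := map_DeltaZ (rho.comp psiD) n
    simp only [AlgHom.comp_apply] at this
    rw [this, map_zpow₀, valX_rho_psiD_Delta, ← WithZero.exp_zsmul]
    congr 1; simp
  rw [map_sub]
  rcases lt_or_gt_of_ne hn with h | h
  · rw [Valuation.map_sub_eq_of_lt_left _ (by rw [h1, h2, WithZero.exp_lt_exp]; omega), h1]
    congr 1; omega
  · rw [Valuation.map_sub_eq_of_lt_right _ (by rw [h1, h2, WithZero.exp_lt_exp]; omega), h2]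
    congr 1; omega

/-- ψ_d fixes q₂ modulo 3, since -2 ≡ 1, so the reduction is Σ pₙ(x)(Δⁿ - ψ_d(Δⁿ)). Nonzero
constants pₙ(x) have order 0, and n ↦ min(n, 2n) is injective, so no cancellation is possible. -/
theorem redP_eq_zero_of_dvd {F : ℤ →₀ Polynomial Z3} (h : 3 ∣ sig F - psiD (sig F)) {n : ℤ}
    (hn : n ≠ 0) : redP (F n) = 0 := by
  have h0 : rho (sig F - psiD (sig F)) = 0 := redB_eq_zero _ _ h
  rw [sig_apply, Finsupp.sum, map_sum, ← Finset.sum_sub_distrib, map_sum] at h0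
  have e (n : ℤ) : rho (Polynomial.aeval q2 (F n) * DeltaZ n -
      psiD (Polynomial.aeval q2 (F n) * DeltaZ n)) =
      RatFunc.C (redP (F n)) * rho (DeltaZ n - psiD (DeltaZ n)) := by
    rw [map_sub, map_mul, map_mul, map_mul, rho_psiD_aeval, rho_aeval, map_sub]
    ring
  simp only [e] at h0
  by_cases hs : n ∈ F.support
  · have h1 := valuation_eq_zero_of_sum_eq_zero (valX _) _ _ (by
      intro i _ j _ hi hj hij
      have hi0 : i ≠ 0 := by rintro rfl; simp [DeltaZ_zero] at hi
      have hj0 : j ≠ 0 := by rintro rfl; simp [DeltaZ_zero] at hj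
      rw [map_mul, map_mul (valX _), valX_rho_DeltaZ_sub hi0, valX_rho_DeltaZ_sub hj0,
        valX_C (fun h => hi (by rw [h, map_zero, zero_mul])),
        valX_C (fun h => hj (by rw [h, map_zero, zero_mul])), one_mul, one_mul,
        WithZero.exp_inj] at hij
      omega) h0 n hs
    rcases mul_eq_zero.1 h1 with h2 | h2
    · exact (map_eq_zero RatFunc.C).1 h2
    · have := valX_rho_DeltaZ_sub hn
      rw [h2, map_zero] at this
      exact absurd this.symm WithZero.exp_ne_zero
  · simp [redP, Finsupp.notMem_support_iff.1 hs]

theorem dvd_coeff_of_redP {p : Polynomial Z3} (h : redP p = 0) (i : ℕ) : 3 ∣ p.coeff i := by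
  have h1 : p.map (algebraMap Z3 Kap) = 0 :=
    (map_eq_zero_iff _ (RatFunc.algebraMap_injective Kap)).1 h
  rw [← algebraMap_Kap_eq_zero, ← Polynomial.coeff_map, h1, Polynomial.coeff_zero]

/-- The classes of `Δ^k q₂`, `k ≠ 0`, are linearly independent modulo `3` in `coker Ψ`. -/
theorem dvd_of_sum_mem_range (u : ℤ →₀ Z3)
    (h : (u.sum fun k c => c • (DeltaZ k * q2)) ∈ LinearMap.range PsiMF) {k : ℤ} (hk : k ≠ 0) :
    3 ∣ u k := by
  obtain ⟨⟨⟨x, hx⟩, y⟩, hxy⟩ := h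
  obtain ⟨F, x', rfl, hF⟩ := exists_of_mem_MF hx
  have hxy' : psiD y - (sig F + 3 * x') + y = u.sum fun k c => c • (DeltaZ k * q2) := hxy
  let G : ℤ →₀ Polynomial Z3 := u.mapRange (fun c => Polynomial.C c * Polynomial.X) (by simp)
  have hG : sig G = u.sum fun k c => c • (DeltaZ k * q2) := by
    rw [sig_apply, Finsupp.sum_mapRange_index (by simp)]
    refine Finsupp.sum_congr fun n _ => ?_
    rw [map_mul, Polynomial.aeval_X, Polynomial.aeval_C, Algebra.smul_def]
    ring
  rw [← hG] at hxy'
  have hs : sig (G + F) = psiD y + y - 3 * x' := by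
    rw [map_add]; linear_combination -hxy'
  obtain ⟨c, hc⟩ := psiTwo_sub y
  -- Modulo 3 the element is ψ_d(y) + y, on which 1 - ψ_d gives y - ψ_[2](y), a multiple of 3.
  have h3 : (3 : B) ∣ sig (G + F) - psiD (sig (G + F)) := by
    rw [hs, map_sub, map_add, map_mul, map_ofNat, psiD_psiD]
    exact ⟨psiD x' - x' - c, by linear_combination -hc⟩
  have h4 := dvd_coeff_of_redP (redP_eq_zero_of_dvd h3 hk) 1
  have h5 : ((G + F) k).coeff 1 = u k + (F k).coeff 1 := by simp [G]
  rw [h5] at h4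
  -- The invariant part contributes nothing to the Δ^k q₂ coefficient modulo 3.
  exact (dvd_add_left (hF k)).1 h4

/-! ### Values of d̃ on Δ^kα -/

theorem dvd_zpow_sub_one {A : Type*} [CommRing A] {a : A} (u : Aˣ) (h : a ∣ (u : A) - 1) (k : ℤ) :
    a ∣ ((u ^ k : Aˣ) : A) - 1 := by
  have e (x : A) : a ∣ x - 1 ↔ Ideal.Quotient.mk (Ideal.span {a}) x = 1 := by
    rw [← map_one (Ideal.Quotient.mk (Ideal.span {a})), Ideal.Quotient.mk_eq_mk_iff_sub_mem,
      Ideal.mem_span_singleton]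
  rw [e] at h ⊢
  have h1 : Units.map (Ideal.Quotient.mk (Ideal.span {a})).toMonoidHom u = 1 :=
    Units.ext h
  have h2 := congrArg (fun v => ((v ^ k : (A ⧸ Ideal.span {a})ˣ) : A ⧸ Ideal.span {a})) h1
  simp only [← map_zpow, one_zpow, Units.val_one, Units.coe_map] at h2
  exact h2

/-- `8` as a unit of `ℤ_(3)`. -/
def eightU : Z3ˣ := (isUnit_int 8 (by norm_num)).unit

theorem coe_eightU : (eightU : Z3) = 8 := by
  change ((8 : ℤ) : Z3) = 8
  norm_num

theorem coe_map_zpow (c : Z3ˣ) (k : ℤ) :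
    (((Units.map (algebraMap Z3 B : Z3 →* B) c) ^ k : Bˣ) : B) =
      algebraMap Z3 B ((c ^ k : Z3ˣ) : Z3) := by
  rw [← map_zpow]; rfl

theorem psiTwo_DeltaZ (k : ℤ) :
    psiTwo (DeltaZ k) = algebraMap Z3 B (((eightU ^ 4) ^ k : Z3ˣ) : Z3) * DeltaZ k := by
  have h : Units.map (psiTwo : B →* B) DeltaU =
      Units.map (algebraMap Z3 B : Z3 →* B) (eightU ^ 4) * DeltaU := Units.ext (by
    change psiTwo Delta = algebraMap Z3 B ((eightU ^ 4 : Z3ˣ) : Z3) * Delta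
    rw [Units.val_pow_eq_pow_val, coe_eightU, map_pow, map_ofNat]
    simp only [Delta, mu, psiTwo, map_mul, map_pow, map_sub, map_ofNat, liftB_q2, liftB_q4]
    ring)
  have h2 := congrArg (fun v : Bˣ => ((v ^ k : Bˣ) : B)) h
  simp only [mul_zpow, Units.val_mul, coe_map_zpow] at h2
  rw [← h2, ← map_zpow]
  rfl

/-- The class of `Δ^k q₂` in `coker Ψ`. -/
def cls (k : ℤ) : H2C := Submodule.Quotient.mk (DeltaZ k * q2)

/-- If 4096^k = 1 + 9e, then Φ(Δ^k r) = (4·4096^k - 1)Δ^k r = 3cΔ^k r = d(cΔ^k q₂) with c = 1 + 12e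
a unit. So y = (-cΔ^k q₂, 0) serves in the zigzag, and Ψ(y) = cΔ^k q₂. -/
theorem dTilde_deltaAlpha (k : ℤ) : ∃ c : Z3ˣ, dTilde (deltaAlpha k) = (c : Z3) • cls k := by
  -- 8⁴ - 1 = 4095 = 9 · 455. The congruence is needed modulo 9 because a factor 3 is divided out.
  obtain ⟨e, he⟩ := dvd_zpow_sub_one (a := (9 : Z3)) (eightU ^ 4) ⟨455, by
    rw [Units.val_pow_eq_pow_val, coe_eightU]; norm_num⟩ k
  obtain ⟨c, hc⟩ := isUnit_of_sub_one (c := 1 + 12 * e) ⟨4 * e, by ring⟩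
  have hp := psiTwo_DeltaZ k
  rw [sub_eq_iff_eq_add.1 he] at hp
  refine ⟨c, ?_⟩
  rw [deltaAlpha, dTilde_mk _ (-(algebraMap Z3 B c * (DeltaZ k * q2)), 0), cls,
    ← Submodule.Quotient.mk_smul]
  · congr 1
    simp only [Psi, LinearMap.add_apply, LinearMap.sub_apply, LinearMap.comp_apply,
      LinearMap.fst_apply, LinearMap.snd_apply, map_zero, AlgHom.toLinearMap_apply, phiF_apply,
      Algebra.smul_def]
    ring
  · simp only [vertMid, LinearMap.neg_apply, LinearMap.comp_apply, LinearMap.fst_apply,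
      cobarZero_apply, PhiOne, LinearMap.sub_apply, AlgHom.toLinearMap_apply, LinearMap.id_apply,
      map_neg, map_mul, psiTwoGam_etaL, psiTwoGam_r, etaR_q2, etaR_DeltaZ, etaR_algebraMap, hp, hc,
      map_add, map_one, map_ofNat]
    ring

theorem three_smul_deltaAlpha (k : ℤ) : (3 : Z3) • deltaAlpha k = 0 := by
  rw [deltaAlpha, ← Submodule.Quotient.mk_smul, Submodule.Quotient.mk_eq_zero]
  refine ⟨DeltaZ k * q2, ?_⟩
  change cobarZero _ = (3 : Z3) • (etaL (DeltaZ k) * r)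
  rw [cobarZero_apply, map_mul, map_mul, etaR_DeltaZ, etaR_q2, Algebra.smul_def, map_ofNat]
  ring

theorem three_smul_cls (k : ℤ) : (3 : Z3) • cls k = 0 := by
  obtain ⟨c, hc⟩ := dTilde_deltaAlpha k
  have h := congrArg dTilde (three_smul_deltaAlpha k)
  rw [map_smul, hc, smul_comm, map_zero] at h
  exact (IsUnit.smul_eq_zero c.isUnit).1 h

/-! ### Relations in coker Ψ and the classes of B^{3k}_v -/

theorem mk_psiD (y : B) : (Submodule.Quotient.mk (psiD y) : H2C) = -Submodule.Quotient.mk y := by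
  rw [← sub_eq_zero, sub_neg_eq_add, ← Submodule.Quotient.mk_add, Submodule.Quotient.mk_eq_zero]
  refine ⟨(0, y), ?_⟩
  simp [PsiMF, Psi]

theorem cls_eq_two_smul (k : ℤ) :
    cls k = (2 : Z3) • (Submodule.Quotient.mk (psiD (DeltaZ k) * q2) : H2C) := by
  have h := mk_psiD (DeltaZ k * q2)
  rw [cls, ← neg_eq_iff_eq_neg.2 h, ← Submodule.Quotient.mk_neg, ← Submodule.Quotient.mk_smul]
  congr 1
  rw [map_mul, Algebra.smul_def, map_ofNat]
  rw [show psiD q2 = -2 * q2 from liftB_q2 ..]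
  ring

theorem cls_zero : cls 0 = 0 := by
  have h := cls_eq_two_smul 0
  rw [DeltaZ_zero, map_one, ← DeltaZ_zero] at h
  change cls 0 = (2 : Z3) • cls 0 at h
  rw [two_smul] at h
  exact left_eq_add.1 h

theorem sU_zpow_mul_tU_zpow (k : ℤ) : ((sU ^ (2 * k) * tU ^ k : Bˣ) : B) =
    algebraMap Z3 B ((eightU ^ k : Z3ˣ) : Z3) * DeltaZ k := by
  have h : sU ^ (2 : ℤ) * tU = Units.map (algebraMap Z3 B : Z3 →* B) eightU * DeltaU :=
    Units.ext (by
      change (8 * q4) ^ 2 * (2 * q2 ^ 2 - 8 * q4) = algebraMap Z3 B (eightU : Z3) * Delta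
      rw [coe_eightU, map_ofNat, Delta, mu]
      ring)
  have h2 := congrArg (fun v : Bˣ => ((v ^ k : Bˣ) : B)) h
  simp only [mul_zpow, ← zpow_mul, Units.val_mul, coe_map_zpow] at h2
  exact h2

theorem eightU_smul_sU_zpow_mul_tU_zpow (k : ℤ) :
    algebraMap Z3 B ((eightU ^ k : Z3ˣ) : Z3) * ((sU ^ k * tU ^ (2 * k) : Bˣ) : B) =
    psiD (DeltaZ k) := by
  have h : Units.map (algebraMap Z3 B : Z3 →* B) eightU * (sU * tU ^ (2 : ℤ)) =
      Units.map (psiD : B →* B) DeltaU :=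
    Units.ext (by
      change algebraMap Z3 B (eightU : Z3) * ((8 * q4) * (2 * q2 ^ 2 - 8 * q4) ^ 2) = psiD Delta
      rw [coe_eightU, map_ofNat]
      simp only [Delta, mu, psiD, map_mul, map_pow, map_sub, map_ofNat, liftB_q2, liftB_q4]
      ring)
  have h2 := congrArg (fun v : Bˣ => ((v ^ k : Bˣ) : B)) h
  simp only [mul_zpow, ← zpow_mul, Units.val_mul, coe_map_zpow] at h2
  rw [Units.val_mul, h2, ← map_zpow]
  rfl

/-- From s²t = 8Δ and 8st² = ψ_d(Δ), 2·8^k times the element is 2ψ_d(Δ^k)q₂ - 2·64^kΔ^k q₂, whose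
class is (1 - 2·64^k) `cls k`; the factor is ≡ -1 modulo 3. -/
theorem mk_aElt (k : ℤ) : ∃ w : Z3ˣ,
    (Submodule.Quotient.mk (aElt k (2 * k) * q2) : H2C) = (w : Z3) • cls k := by
  have h64 := dvd_zpow_sub_one (a := (3 : Z3)) (eightU ^ 2) ⟨21, by
    rw [Units.val_pow_eq_pow_val, coe_eightU]; norm_num⟩ k
  have h64' : (((eightU ^ 2) ^ k : Z3ˣ) : Z3) = (eightU ^ k : Z3ˣ) ^ 2 := by
    rw [← Units.val_pow_eq_pow_val, ← zpow_natCast, ← zpow_natCast, ← zpow_mul, ← zpow_mul,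
      mul_comm]
  rw [h64'] at h64
  set v : Z3ˣ := eightU ^ k with hv
  obtain ⟨e, he⟩ := h64
  obtain ⟨w, hw⟩ := isUnit_of_add_one (c := 1 - 2 * (v : Z3) ^ 2) ⟨-2 * e, by
    linear_combination -2 * he⟩
  have hu : IsUnit (2 * (v : Z3)) := by
    have h2 := isUnit_int 2 (by norm_num)
    rw [Int.cast_ofNat] at h2
    exact h2.mul v.isUnit
  obtain ⟨u, hu⟩ := hu
  have key : (u : Z3) • (Submodule.Quotient.mk (aElt k (2 * k) * q2) : H2C) = (w : Z3) • cls k := by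
    have h1 : (u : Z3) • (aElt k (2 * k) * q2) =
        (2 : Z3) • (psiD (DeltaZ k) * q2) - (2 * (v : Z3) ^ 2) • (DeltaZ k * q2) := by
      simp only [hu, Algebra.smul_def, aElt, sU_zpow_mul_tU_zpow, map_mul, map_pow, map_ofNat,
        ← eightU_smul_sU_zpow_mul_tU_zpow, ← hv]
      ring
    rw [← Submodule.Quotient.mk_smul, h1, Submodule.Quotient.mk_sub, Submodule.Quotient.mk_smul,
      ← cls_eq_two_smul, Submodule.Quotient.mk_smul, hw, sub_smul, one_smul, cls]
  refine ⟨u⁻¹ * w, ?_⟩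
  rw [Units.val_mul, mul_smul, ← key, smul_smul, Units.inv_mul, one_smul]

theorem floor_half (m : ℤ) : ⌊((m : ℚ) - 1) / 2⌋ = (m - 1) / 2 := by
  rw [Int.floor_eq_iff]
  have h1 : ((m - 1) / 2 * 2 : ℤ) ≤ m - 1 := by omega
  have h2 : m - 1 < ((m - 1) / 2 + 1) * 2 := by omega
  have h1' := (Int.cast_le (R := ℚ)).2 h1
  have h2' := (Int.cast_lt (R := ℚ)).2 h2
  push_cast at h1' h2'
  constructor <;> linarith

theorem ceil_half (m : ℤ) : ⌈((m : ℚ) + 1) / 2⌉ = m - (m - 1) / 2 := by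
  rw [Int.ceil_eq_iff]
  have h1 : (m - (m - 1) / 2 - 1) * 2 < m + 1 := by omega
  have h2 : m + 1 ≤ (m - (m - 1) / 2) * 2 := by omega
  have h1' := (Int.cast_lt (R := ℚ)).2 h1
  have h2' := (Int.cast_le (R := ℚ)).2 h2
  push_cast at h1' h2' ⊢
  constructor <;> linarith

theorem vIndex_eq (k : ℤ) : vIndex k = (3 * k - 1) / 2 - if 0 < k then k else 2 * k := by
  have := floor_half (3 * k)
  push_cast at this
  rw [vIndex, this]

theorem vIndex_nonneg {k : ℤ} (hk : k ≠ 0) : 0 ≤ vIndex k := by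
  rw [vIndex_eq]
  split_ifs <;> omega

/-- The index v(k) is chosen so that (i, j) is (k, 2k) for k > 0 and (2k, k) for k < 0; the swap
only changes the sign. -/
theorem BClass_eq (k : ℤ) : ∃ w : Z3ˣ, BClass (3 * k) (vIndex k) = (w : Z3) • cls k := by
  obtain ⟨w, hw⟩ := mk_aElt k
  rw [BClass, BElt, floor_half, ceil_half, vIndex_eq, bElt]
  split_ifs with h
  · refine ⟨w, ?_⟩
    rw [← hw]
    congr 3 <;> ring
  · refine ⟨-w, ?_⟩
    rw [Units.val_neg, neg_smul, ← hw, ← Submodule.Quotient.mk_neg, ← neg_mul]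
    congr 2
    rw [show -aElt k (2 * k) = aElt (2 * k) k by simp [aElt]]
    congr 1 <;> ring

/-! ### Kernel of d̃ -/

theorem dvd_of_sum_cls (u : ℤ →₀ Z3) (h : (u.sum fun k c => c • cls k) = 0) {k : ℤ} (hk : k ≠ 0) :
    3 ∣ u k := by
  refine dvd_of_sum_mem_range u ?_ hk
  rw [← Submodule.Quotient.mk_eq_zero, ← h]
  exact map_finsuppSum (LinearMap.range PsiMF).mkQ _ _

theorem cls_ne_zero {k : ℤ} (hk : k ≠ 0) : cls k ≠ 0 := fun h => by
  have := dvd_of_sum_cls (Finsupp.single k 1) (by simp [h]) hk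
  rw [Finsupp.single_eq_same] at this
  exact prime_three_Z3.not_isUnit (isUnit_of_dvd_one this)

theorem exists_sum_deltaAlpha (x : Ext1) :
    ∃ c : ℤ →₀ Z3, x = c.sum fun k a => a • deltaAlpha k := by
  obtain ⟨⟨z, hz⟩, rfl⟩ := Submodule.Quotient.mk_surjective _ x
  obtain ⟨c, w, hw⟩ := exists_of_cocycle hz
  refine ⟨c, ?_⟩
  let f : LinearMap.ker cobarOne := c.sum fun k a => a • ⟨etaL (DeltaZ k) * r, cobarOne_Delta_r k⟩
  have hf : (Submodule.Quotient.mk f : Ext1) = c.sum fun k a => a • deltaAlpha k :=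
    map_finsuppSum (Submodule.mkQ _) _ _
  rw [← hf, Submodule.Quotient.eq]
  refine ⟨w, ?_⟩
  have hf' : (f : Gam) = etaL (c.sum fun n a => algebraMap Z3 B a * DeltaZ n) * r := by
    rw [map_finsuppSum, Finsupp.sum_mul]
    refine (map_finsuppSum (LinearMap.ker cobarOne).subtype _ _).trans
      (Finsupp.sum_congr fun n _ => ?_)
    rw [map_mul, AlgHom.commutes, mul_assoc, ← Algebra.smul_def]
    rfl
  change cobarZero w = z - (f : Gam)
  rw [hf', hw]
  ring

theorem alpha_eq : alpha = deltaAlpha 0 := by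
  rw [alpha, deltaAlpha]
  congr 2
  change r = etaL (DeltaZ 0) * r
  rw [DeltaZ_zero, map_one, one_mul]

theorem smul_alpha_eq_zero (c : Z3) : c • alpha = 0 ↔ 3 ∣ c := by
  constructor
  · intro h
    rw [alpha, ← Submodule.Quotient.mk_smul, Submodule.Quotient.mk_eq_zero] at h
    obtain ⟨b, hb⟩ := h
    exact dvd_of_smul_r_eq (b := b) hb.symm
  · rintro ⟨d, rfl⟩
    rw [mul_comm, mul_smul, alpha_eq, three_smul_deltaAlpha, smul_zero]

theorem smul_deltaAlpha_eq_zero {c : Z3} (h : 3 ∣ c) (k : ℤ) : c • deltaAlpha k = 0 := by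
  obtain ⟨d, rfl⟩ := h
  rw [mul_comm, mul_smul, three_smul_deltaAlpha, smul_zero]

theorem ker_dTilde : LinearMap.ker dTilde = Submodule.span Z3 {alpha} := by
  apply le_antisymm
  · intro x hx
    obtain ⟨c, rfl⟩ := exists_sum_deltaAlpha x
    choose u hu using dTilde_deltaAlpha
    have h (k : ℤ) (hk : k ≠ 0) : 3 ∣ c k := by
      let d : ℤ →₀ Z3 := Finsupp.onFinset c.support (fun k => c k * u k) fun k hk => by
        rw [Finsupp.mem_support_iff]
        exact left_ne_zero_of_mul hk
      have hd : (d.sum fun k a => a • cls k) = 0 := by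
        rw [Finsupp.onFinset_sum _ (fun k => zero_smul Z3 (cls k))]
        refine Eq.trans ?_ (LinearMap.mem_ker.1 hx)
        rw [map_finsuppSum]
        refine Finset.sum_congr rfl fun k _ => ?_
        simp only [map_smul, hu, smul_smul]
      have h1 : 3 ∣ c k * u k := dvd_of_sum_cls d hd hk
      exact ((u k).isUnit.dvd_mul_right).1 h1
    refine Submodule.sum_mem (Submodule.span Z3 {alpha}) fun k _ => ?_
    rcases eq_or_ne k 0 with rfl | hk
    · simp only [← alpha_eq]
      exact Submodule.smul_mem _ _ (Submodule.mem_span_singleton_self _)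
    · simp only [smul_deltaAlpha_eq_zero (h k hk), Submodule.zero_mem]
  · rw [Submodule.span_singleton_le_iff_mem, LinearMap.mem_ker, alpha_eq]
    obtain ⟨c, hc⟩ := dTilde_deltaAlpha 0
    rw [hc, cls_zero, smul_zero]

theorem nonempty_ker_dTilde_equiv : Nonempty (LinearMap.ker dTilde ≃ₗ[Z3] ZModThreePow 1) := by
  have hk : LinearMap.ker (LinearMap.toSpanSingleton Z3 Ext1 alpha) = Ideal.span {(3 : Z3) ^ 1} := by
    ext c
    rw [LinearMap.mem_ker, LinearMap.toSpanSingleton_apply, smul_alpha_eq_zero, pow_one,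
      Ideal.mem_span_singleton]
  have hr : LinearMap.range (LinearMap.toSpanSingleton Z3 Ext1 alpha) = LinearMap.ker dTilde := by
    rw [ker_dTilde, LinearMap.range_toSpanSingleton]
  exact ⟨(LinearEquiv.ofEq _ _ hr.symm).trans
    ((LinearMap.quotKerEquivRange _).symm.trans (Submodule.quotEquivOfEq _ _ hk))⟩

/-! ### The direct sum and the image of d̃ -/

/-- Since 18k + 3 = 3(6k + 1), every summand is ℤ/3, matching `three_smul_cls`. -/
theorem padicValInt_eq_one (k : ℤ) : padicValInt 3 (6 * (3 * k) + 3) = 1 := by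
  have h : ¬ (3 : ℤ) ∣ 6 * k + 1 := by omega
  rw [show 6 * (3 * k) + 3 = 3 * (6 * k + 1) by ring, padicValInt.mul (by norm_num) (by omega),
    show padicValInt 3 3 = 1 from padicValInt.self (by norm_num),
    padicValInt.eq_zero_of_not_dvd h]

/-- The map from `ℤ/3^{ν₃(6m+3)}`, `m = 3k`, to `coker Ψ` which sends `1` to the class of
`B^{3k}_{v(k)}`. -/
def iotaAt (k : ℤ) : ZModThreePow (padicValInt 3 (6 * (3 * k) + 3)) →ₗ[Z3] H2C :=
  (Ideal.span {(3 : Z3) ^ padicValInt 3 (6 * (3 * k) + 3)}).liftQ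
    (LinearMap.toSpanSingleton Z3 H2C (BClass (3 * k) (vIndex k))) (by
      obtain ⟨w, hw⟩ := BClass_eq k
      refine (Submodule.span_singleton_le_iff_mem _ _).2 ?_
      rw [LinearMap.mem_ker,
        LinearMap.toSpanSingleton_apply, padicValInt_eq_one, pow_one, hw, smul_comm,
        three_smul_cls, smul_zero])

theorem iotaAt_mk (k : ℤ) (c : Z3) :
    iotaAt k (Submodule.Quotient.mk c) = c • BClass (3 * k) (vIndex k) := rfl

/-- The direct sum of the maps `iotaAt k`, `k ≠ 0`. -/
def iota : (⨁ k : {k : ℤ // k ≠ 0}, ZModThreePow (padicValInt 3 (6 * (3 * k.1) + 3))) →ₗ[Z3] H2C :=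
  DirectSum.toModule Z3 {k : ℤ // k ≠ 0} H2C fun k => iotaAt k.1

theorem iota_lof_one (k : {k : ℤ // k ≠ 0}) : iota (DirectSum.lof Z3 {k : ℤ // k ≠ 0}
    (fun k => ZModThreePow (padicValInt 3 (6 * (3 * k.1) + 3))) k 1) =
      BClass (3 * k.1) (vIndex k.1) := by
  rw [iota, DirectSum.toModule_lof]
  exact (iotaAt_mk k.1 1).trans (one_smul _ _)

theorem iota_injective : Function.Injective iota := by
  classical
  rw [injective_iff_map_eq_zero]
  intro x hx
  choose w hw using BClass_eq
  choose c hc using fun k : {k : ℤ // k ≠ 0} => Submodule.Quotient.mk_surjective _ (x k)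
  let s := DFinsupp.support x
  have h1 : iota x = ∑ k ∈ s, (c k * (w k.1 : Z3)) • cls k.1 := by
    conv_lhs => rw [← DirectSum.sum_support_of x, map_sum]
    refine Finset.sum_congr rfl fun k _ => ?_
    have : iota (DirectSum.of _ k (x k)) = iotaAt k.1 (x k) := DirectSum.toModule_lof ..
    rw [this, ← hc, iotaAt_mk, hw, smul_smul]
  -- Lifted coefficients, extended by zero to all of ℤ so that `dvd_of_sum_cls` applies; the units
  -- `w` do not affect divisibility by 3.
  let u : ℤ →₀ Z3 := ∑ k ∈ s, Finsupp.single k.1 (c k * (w k.1 : Z3))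
  have h2 : (u.sum fun k a => a • cls k) = 0 := by
    rw [← hx, h1, ← Finsupp.sum_finsetSum_index (by simp) (by intros; rw [add_smul])]
    exact Finset.sum_congr rfl fun k _ => Finsupp.sum_single_index (by simp)
  refine DFinsupp.ext fun k => ?_
  by_cases hk : k ∈ s
  · have h3 := dvd_of_sum_cls u h2 k.2
    have h4 : u k.1 = c k * (w k.1 : Z3) := by
      simp only [u, Finsupp.finsetSum_apply]
      rw [Finset.sum_eq_single_of_mem k hk, Finsupp.single_eq_same]
      intro l _ hl
      exact Finsupp.single_eq_of_ne (fun h => hl (Subtype.ext h.symm))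
    rw [h4, (w k.1).isUnit.dvd_mul_right] at h3
    rw [DFinsupp.zero_apply, ← hc]
    refine (Submodule.Quotient.mk_eq_zero _).2 ?_
    rwa [padicValInt_eq_one, pow_one, Ideal.mem_span_singleton]
  · exact DFinsupp.notMem_support_iff.1 hk

theorem dTilde_deltaAlpha_eq (k : ℤ) :
    ∃ u : Z3ˣ, dTilde (deltaAlpha k) = (u : Z3) • BClass (3 * k) (vIndex k) := by
  obtain ⟨c, hc⟩ := dTilde_deltaAlpha k
  obtain ⟨w, hw⟩ := BClass_eq k
  refine ⟨c * w⁻¹, ?_⟩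
  rw [hc, hw, smul_smul, Units.val_mul, mul_assoc, Units.inv_mul, mul_one]

theorem range_dTilde : LinearMap.range dTilde = LinearMap.range iota := by
  apply le_antisymm
  · rintro _ ⟨x, rfl⟩
    obtain ⟨c, rfl⟩ := exists_sum_deltaAlpha x
    rw [map_finsuppSum]
    refine Submodule.sum_mem _ fun k _ => ?_
    simp only [map_smul]
    refine Submodule.smul_mem _ _ ?_
    rcases eq_or_ne k 0 with rfl | hk
    · obtain ⟨u, hu⟩ := dTilde_deltaAlpha 0
      rw [hu, cls_zero, smul_zero]
      exact Submodule.zero_mem _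
    · obtain ⟨u, hu⟩ := dTilde_deltaAlpha_eq k
      rw [hu]
      exact Submodule.smul_mem _ _ ⟨_, iota_lof_one ⟨k, hk⟩⟩
  · rintro _ ⟨x, rfl⟩
    induction x using DirectSum.induction_on with
    | zero => rw [map_zero]; exact Submodule.zero_mem _
    | add x y hx hy => rw [map_add]; exact Submodule.add_mem _ hx hy
    | of k x =>
      obtain ⟨c, rfl⟩ := Submodule.Quotient.mk_surjective _ x
      have : iota (DirectSum.of _ k (Submodule.Quotient.mk c)) =
        iotaAt k.1 (Submodule.Quotient.mk c) := DirectSum.toModule_lof ..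
      obtain ⟨u, hu⟩ := dTilde_deltaAlpha_eq k.1
      rw [this, iotaAt_mk]
      refine Submodule.smul_mem _ _ ⟨((u⁻¹ : Z3ˣ) : Z3) • deltaAlpha k.1, ?_⟩
      rw [map_smul, hu, smul_smul, Units.inv_mul, one_smul]

theorem BClass_ne_zero {k : ℤ} (hk : k ≠ 0) : BClass (3 * k) (vIndex k) ≠ 0 := by
  obtain ⟨w, hw⟩ := BClass_eq k
  rw [hw, Ne, w.isUnit.smul_eq_zero]
  exact cls_ne_zero hk

end QTwo

end

theorem theorem2p5 :
    (LinearMap.ker QTwo.dTilde = Submodule.span QTwo.Z3 {QTwo.alpha} ∧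
      Nonempty (LinearMap.ker QTwo.dTilde ≃ₗ[QTwo.Z3] QTwo.ZModThreePow 1)) ∧
    (∀ k : ℤ, k ≠ 0 → 0 ≤ QTwo.vIndex k ∧ QTwo.BClass (3 * k) (QTwo.vIndex k) ≠ 0 ∧
      ∃ u : QTwo.Z3ˣ, QTwo.dTilde (QTwo.deltaAlpha k) =
        (u : QTwo.Z3) • QTwo.BClass (3 * k) (QTwo.vIndex k)) ∧
    ∃ ι : (⨁ k : {k : ℤ // k ≠ 0}, QTwo.ZModThreePow (padicValInt 3 (6 * (3 * k.1) + 3)))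
        →ₗ[QTwo.Z3] QTwo.H2C,
      Function.Injective ι ∧
      (∀ k : {k : ℤ // k ≠ 0},
        ι (DirectSum.lof QTwo.Z3 {k : ℤ // k ≠ 0}
          (fun k => QTwo.ZModThreePow (padicValInt 3 (6 * (3 * k.1) + 3))) k 1) =
            QTwo.BClass (3 * k.1) (QTwo.vIndex k.1)) ∧
      LinearMap.range QTwo.dTilde = LinearMap.range ι ∧
      ∃ e : (QTwo.H2C ⧸ LinearMap.range QTwo.dTilde) ≃ₗ[QTwo.Z3] (QTwo.H2C ⧸ LinearMap.range ι),
        ∀ x : QTwo.H2C, e (Submodule.Quotient.mk x) = Submodule.Quotient.mk x := by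
  refine ⟨⟨QTwo.ker_dTilde, QTwo.nonempty_ker_dTilde_equiv⟩, fun k hk =>
    ⟨QTwo.vIndex_nonneg hk, QTwo.BClass_ne_zero hk, QTwo.dTilde_deltaAlpha_eq k⟩,
    QTwo.iota, QTwo.iota_injective, QTwo.iota_lof_one, QTwo.range_dTilde,
    Submodule.quotEquivOfEq _ _ QTwo.range_dTilde, fun x => rfl⟩
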